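/- **Notation.** Let $n\ge 0$, and let $\mathfrak S_n=\{0,1\}^n$ with $|\mathbf i|=i_1+\dots+i_n$ and $\mathbf j\prec\mathbf i$ iff $j_t\le i_t$ for all $t$. Let $S_n=\mathbb C^n\setminus D_n$, where $D_n$ is the divisor $\prod_{j}x_j(1-x_j)\prod_{j<k}(1-x_j\cdots x_k)=0$. For $\mathbf y\in\mathbb C^k$ put $a_0(\mathbf y)=0$, $a_s(\mathbf y)=(y_s\cdots y_k)^{-1}$ for $1\le s\le k$, $a_{k+1}(\mathbf y)=1$, and $\theta_s(\mathbf y)=dt/(t-a_s(\mathbf y))$. For $\mathbf j\in\mathfrak S_k$ with ones at the places $t_1<\dots<t_l$, and with $t_0=0$, $t_{l+1}=k+1$, put $$\gamma^k_{\mathbf j}(\mathbf y)=(-1)^{k-l}\prod_{r=0}^{l}\int_{p_r}\theta_{t_r+1}(\mathbf y)\cdots\theta_{t_{r+1}-1}(\mathbf y),$$ a product of Chen iterated integrals (empty ones are $1$; $\int_p w_1\cdots w_m$ is the integral over $u_1\le\dots\le u_m$), where $p_r$ is a path from $a_{t_r}(\mathbf y)$ to $a_{t_{r+1}}(\mathbf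 y)$ that avoids the points $a_s(\mathbf y)$, $t_r<s<t_{r+1}$. For $\mathbf i\in\mathfrak S_n$ with ones at $\tau_1<\dots<\tau_k$ and $\tau_{k+1}=n+1$, let $\mathbf x(\mathbf i)=(y_1,\dots,y_k)$ with $y_m=\prod_{\tau_m\le\alpha<\tau_{m+1}}x_\alpha$, and let $\rho_{\mathbf i}(\mathbf j)\in\mathfrak S_k$ be obtained from $\mathbf j$ by deleting the components at which $\mathbf i$ is $0$. The variation matrix $\mathcal M_{[n]}(\mathbf x)$, a multi-valued $2^n\times2^n$ matrix on $S_n$, has the $(\mathbf i,\mathbf j)$ entry $(2\pi i)^{|\mathbf j|}\gamma^{|\mathbf i|}_{\rho_{\mathbf i}(\mathbf j)}(\mathbf x(\mathbf i))$ if $\mathbf j\prec\mathbf i$, and $0$ otherwise. Here, for each $\mathbf j$ with ones at $t_1<\dots<t_l$ ($t_0=0$, $t_{l+1}=n+1$), the paths $p_r$ from $a_{t_r}(\mathbf x)$ to $a_{t_{r+1}}(\mathbf x)$ are the same for all $\mathbf i$, and avoid $a_s(\mathbf x)$ for $t_r<s<t_{r+1}$. A branch of $\mathcal M_{[n]}$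 on an open set $U\subseteq S_n$ is given by a choice of such paths that varies smoothly with $\mathbf x\in U$. **Proposition.** At every point of $S_n$ such paths exist, and every choice of ($C^2$) paths at a point extends to a branch on a neighbourhood. There are single-valued holomorphic $1$-forms on $S_n$, the entries $c_{\mathbf i,\mathbf k}$ of a matrix $\boldsymbol\omega$, such that $c_{\mathbf i,\mathbf k}=d\gamma^{|\mathbf i|}_{\rho_{\mathbf i}(\mathbf k)}(\mathbf x(\mathbf i))$ (for every branch) if $\mathbf k\prec\mathbf i$ and $|\mathbf k|=|\mathbf i|-1$, and $c_{\mathbf i,\mathbf k}=0$ otherwise; explicitly, in the first case, if $s$ is the place of the only $0$ of $\rho_{\mathbf i}(\mathbf k)$ and $\mathbf y=\mathbf x(\mathbf i)$, then $c_{\mathbf i,\mathbf k}=-d\log\frac{a_{s+1}(\mathbf y)-a_s(\mathbf y)}{a_{s-1}(\mathbf y)-a_s(\mathbf y)}$. In particular $\boldsymbol\omega$ is strictly lower triangular, so that the system $$dX=\boldsymbol\omega X,\qquad\text{i.e.}\quad dX_{\mathbf 0}=0,\quad dX_{\mathbf i}=\sum_{|\mathbf k|=|\mathbf i|-1,\ \mathbf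 k\prec\mathbf i}X_{\mathbf k}\,d\gamma^{|\mathbf i|}_{\rho_{\mathbf i}(\mathbf k)}(\mathbf x(\mathbf i))\quad(1\le|\mathbf i|\le n),$$ is unipotent. For every branch of $\mathcal M_{[n]}$ on an open set $U\subseteq S_n$ the columns are solutions of this system, the matrix is invertible at every point of $U$, and, if $U$ is connected and non-empty, every holomorphic solution on $U$ is a unique $\mathbb C$-linear combination of the columns. Moreover $\boldsymbol\omega$ is integrable: $d\boldsymbol\omega=0$ and $\boldsymbol\omega\wedge\boldsymbol\omega=0$ on $S_n$. Every entry of $\boldsymbol\omega$ is an integral linear combination of the forms $d\log x_j$ and $d\log(1-x_j\cdots x_k)$, $j\le k$, and it has at most logarithmic poles on $\mathbb{CP}^n$ along $\mathcal D_n=D_n\cup(\mathbb{CP}^n\setminus\mathbb C^n)$: if $h$ is the reduced equation of $\mathcal D_n$ in a standard affine chart, then $h\,c_{\mathbf i,\mathbf k}$ and $h\,dc_{\mathbf i,\mathbf k}$ extend holomorphically to the chart. -/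

import Mathlib

open Finset Matrix

noncomputable section

namespace MultiLog

/-- The index set `{0,1}^n`: a 0/1-vector is encoded by the set of places where it equals `1`.
The weight `|i|` is `i.card`, the partial order `j ≺ i` (componentwise `≤`) is `j ⊆ i`, and the
place number `α : Fin n` is the place `α + 1` in one-based counting. -/
abbrev Idx (n : ℕ) : Type := Finset (Fin n)

/-- `C^n`. -/
abbrev Pt (n : ℕ) : Type := Fin n → ℂ

/-- Complex linear forms on `C^n`, the values of a differential `1`-form of type `(1,0)`. -/
abbrev Form (n : ℕ) : Type := Pt n →L[ℂ] ℂ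

/-- `S_n = C^n ∖ D_n`, where `D_n` is the divisor
`∏_j x_j (1 - x_j) ∏_{j<k} (1 - x_j ⋯ x_k) = 0`. -/
def S (n : ℕ) : Set (Pt n) :=
  {x | (∏ j, x j * (1 - x j)) *
    (∏ j, ∏ k ∈ univ.filter (fun k => j < k), (1 - ∏ α ∈ Icc j k, x α)) ≠ 0}

/-- The points `a_0 = 0`, `a_s = 1 / (x_s x_{s+1} ⋯ x_n)` for `1 ≤ s ≤ n`, and `a_{n+1} = 1`. -/
def a {n : ℕ} (x : Pt n) (s : ℕ) : ℂ :=
  if s = 0 then 0 else (∏ α ∈ univ.filter (fun α : Fin n => s ≤ (α : ℕ) + 1), x α)⁻¹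

/-- For an index `j` of weight `l` whose ones are at the places `t_1 < ⋯ < t_l`, the number
`t_r`, with the conventions `t_0 = 0` and `t_{l+1} = n + 1`. -/
def place {n : ℕ} (j : Idx n) : ℕ → ℕ
  | 0 => 0
  | r + 1 => if h : r < j.card then ((j.orderEmbOfFin rfl ⟨r, h⟩ : Fin n) : ℕ) + 1 else n + 1

/-- The point `x(i) = (y_1, …, y_k)`, `k = |i|`, where `y_m = ∏_{τ_m ≤ α < τ_{m+1}} x_α` and
`τ_1 < ⋯ < τ_k` are the places of the ones of `i`, `τ_{k+1} = n + 1`. -/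
def sub {n : ℕ} (i : Idx n) (x : Pt n) : Pt i.card := fun m =>
  ∏ α ∈ univ.filter (fun α : Fin n =>
    place i ((m : ℕ) + 1) ≤ (α : ℕ) + 1 ∧ (α : ℕ) + 1 < place i ((m : ℕ) + 2)), x α

/-- The retraction `ρ_i`: delete from `j` the components at which `i` is `0`. -/
def retract {n : ℕ} (i j : Idx n) : Idx i.card :=
  univ.filter (fun m => i.orderEmbOfFin rfl m ∈ j)

/-- Chen's iterated integral
`∫_{0 ≤ u_1 ≤ ⋯ ≤ u_m ≤ t} w_1(u_1) ⋯ w_m(u_m) du_1 ⋯ du_m`; it is `1` for `m = 0`. -/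
def iterInt : (m : ℕ) → (Fin m → ℝ → ℂ) → ℝ → ℂ
  | 0, _, _ => 1
  | m + 1, w, t => ∫ u in (0 : ℝ)..t, iterInt m (Fin.init w) u * w (Fin.last m) u

/-- The pull-back of `dz / (z - b)` to `[0,1]` along the path `p`. -/
def pullTheta (b : ℂ) (p : ℝ → ℂ) (u : ℝ) : ℂ :=
  derivWithin p (Set.Icc 0 1) u / (p u - b)

/-- The value of
`γ_j^k(y) = (-1)^{k-l} ∏_{r=0}^{l} ∫_{p_r} θ_{t_r+1}(y) ⋯ θ_{t_{r+1}-1}(y)`, where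
`θ_s(y) = dt / (t - a_s(y))` and `t_1 < ⋯ < t_l` are the places of the ones of `j`, determined by
the paths `p_0, …, p_l`, the path `p_r` leading from `a_{t_r}(y)` to `a_{t_{r+1}}(y)`. -/
def gamma {k : ℕ} (j : Idx k) (y : Pt k) (p : ℕ → ℝ → ℂ) : ℂ :=
  (-1) ^ (k - j.card) * ∏ r ∈ range (j.card + 1),
    iterInt (place j (r + 1) - place j r - 1)
      (fun q => pullTheta (a y (place j r + 1 + (q : ℕ))) (p r)) 1

/-- A choice of integration paths at the point `x`: for every index `j` (the column), with ones at
the places `t_1 < ⋯ < t_l`, paths `p j 0, …, p j l`, where `p j r` leads from `a_{t_r}(x)` to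
`a_{t_{r+1}}(x)` and avoids the points `a_s(x)` with `t_r < s < t_{r+1}`. -/
structure IsPathSystem {n : ℕ} (x : Pt n) (p : Idx n → ℕ → ℝ → ℂ) : Prop where
  smooth : ∀ j, ∀ r ≤ j.card, ContDiffOn ℝ 2 (p j r) (Set.Icc 0 1)
  source : ∀ j, ∀ r ≤ j.card, p j r 0 = a x (place j r)
  target : ∀ j, ∀ r ≤ j.card, p j r 1 = a x (place j (r + 1))
  avoid : ∀ j, ∀ r ≤ j.card, ∀ t ∈ Set.Icc (0 : ℝ) 1, ∀ s, place j r < s → s < place j (r + 1) →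
    p j r t ≠ a x s

/-- A choice of integration paths at every point of `U` which varies smoothly with the point.
Such a choice singles out a branch on `U` of the multi-valued functions `γ`. -/
structure IsPathFamily {n : ℕ} (U : Set (Pt n)) (p : Idx n → ℕ → Pt n → ℝ → ℂ) : Prop where
  system : ∀ x ∈ U, IsPathSystem x (fun j r => p j r x)
  smooth : ∀ j, ∀ r ≤ j.card,
    ContDiffOn ℝ 2 (fun z : Pt n × ℝ => p j r z.1 z.2) (U ×ˢ Set.Icc (0 : ℝ) 1)

/-- The value at `x` of `E_{i,j}(x) = γ^{|i|}_{ρ_i(j)}(x(i))` if `j ≺ i`, and `0` otherwise.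
The paths depend on the column `j` only, and not on `i`. -/
def entry {n : ℕ} (p : Idx n → ℕ → ℝ → ℂ) (x : Pt n) (i j : Idx n) : ℂ :=
  if j ⊆ i then gamma (retract i j) (sub i x) (p j) else 0

/-- The value at `x` of the variation matrix `M_{[n]}(x) = [(2πi)^{|j|} E_{i,j}(x)]` which is
determined by a choice of paths. -/
def varMatrix {n : ℕ} (p : Idx n → ℕ → ℝ → ℂ) (x : Pt n) : Matrix (Idx n) (Idx n) ℂ :=
  Matrix.of fun i j => (2 * (Real.pi : ℂ) * Complex.I) ^ j.card * entry p x i j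

/-- `d log f = df / f`. -/
def dlog {n : ℕ} (f : Pt n → ℂ) (x : Pt n) : Form n := (f x)⁻¹ • fderiv ℂ f x

/-- The connection form. The entry at `(i, j)` is `0` unless `j ≺ i` and `|j| = |i| - 1`.
In that case `ρ_i(j)` has exactly one zero, at the place `s = m + 1`, and with `y = x(i)` the entry
is `- d log ((a_{s+1}(y) - a_s(y)) / (a_{s-1}(y) - a_s(y)))`. -/
def omega {n : ℕ} (x : Pt n) : Matrix (Idx n) (Idx n) (Form n) :=
  Matrix.of fun i j =>
    if j ⊆ i ∧ j.card + 1 = i.card then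
      ∑ m ∈ (retract i j)ᶜ, -dlog (fun x' : Pt n =>
        (a (sub i x') ((m : ℕ) + 2) - a (sub i x') ((m : ℕ) + 1)) /
          (a (sub i x') (m : ℕ) - a (sub i x') ((m : ℕ) + 1))) x
    else 0

/-- `ω(x)(v)`, the matrix of values of the entries of `ω` at the tangent vector `v`. -/
def omegaAt {n : ℕ} (x v : Pt n) : Matrix (Idx n) (Idx n) ℂ :=
  Matrix.of fun i j => omega x i j v

/-- `X` is a (holomorphic) solution on the open set `U` of the system `dX = ω X`. -/
def IsSolution {n : ℕ} (U : Set (Pt n)) (X : Pt n → Idx n → ℂ) : Prop :=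
  ∀ x ∈ U, ∀ i, HasFDerivAt (fun x' => X x' i) (∑ k, X x k • omega x i k) x

/-- A `1`-form as an alternating form, so that `extDeriv` applies to it. -/
def asAlt {n : ℕ} (η : Pt n → Form n) (x : Pt n) : Pt n [⋀^Fin 1]→L[ℂ] ℂ :=
  ContinuousAlternatingMap.ofSubsingleton ℂ (Pt n) ℂ (0 : Fin 1) (η x)

/-- The `1`-form `η`, given off the hypersurface `h = 0` of `C^n` with reduced equation `h`, has
(at most) logarithmic poles along it: `h η` and `h dη` extend to holomorphic forms. -/
def HasLogPoles {n : ℕ} (h : Pt n → ℂ) (η : Pt n → Form n) : Prop :=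
  (∃ α : Pt n → Form n, Differentiable ℂ α ∧ ∀ u, h u ≠ 0 → h u • η u = α u) ∧
  (∃ β : Pt n → (Pt n [⋀^Fin 2]→L[ℂ] ℂ), Differentiable ℂ β ∧
    ∀ u, h u ≠ 0 → h u • extDeriv (asAlt η) u = β u)

/-- The standard chart of `CP^n` on which the homogeneous coordinate `X_m` is not zero, written as
`u ↦ [X_0 : ⋯ : X_n]` with `X_m = 1`. -/
def homog {n : ℕ} (m : Fin (n + 1)) (u : Pt n) : Pt (n + 1) :=
  Fin.insertNth (α := fun _ => ℂ) m 1 u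

/-- The coordinates `x_j = X_j / X_0` of the embedded `C^n` in terms of the `m`-th chart. -/
def toAffine {n : ℕ} (m : Fin (n + 1)) (u : Pt n) : Pt n :=
  fun j => homog m u j.succ / homog m u 0

/-- The equation, in the `m`-th chart of `CP^n`, of the union of the closure of `D_n` and of the
hyperplane at infinity `X_0 = 0`. The homogeneous equation is
`X_0 ∏_j X_j ∏_{j ≤ k} (X_0^{k-j+1} - X_j ⋯ X_k) = 0`, a product of pairwise distinct irreducible
factors. -/
def divisorEq {n : ℕ} (m : Fin (n + 1)) (u : Pt n) : ℂ :=
  homog m u 0 * (∏ j : Fin n, homog m u j.succ) *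
    ∏ j : Fin n, ∏ k ∈ univ.filter (fun k => j ≤ k),
      (homog m u 0 ^ (Icc j k).card - ∏ α ∈ Icc j k, homog m u α.succ)

/-- The pull-back to the `m`-th chart of `CP^n` of a `1`-form on an open subset of `C^n`. -/
def inChart {n : ℕ} (m : Fin (n + 1)) (η : Pt n → Form n) (u : Pt n) : Form n :=
  (η (toAffine m u)).comp (fderiv ℂ (toAffine m) u)

end MultiLog

end

open MultiLog

/-!
The points `a_q(x(i))` are the points `a_s(x)` at the places `s` of the ones of `i` (`a_sub`), so the
entry at `(i, j)` is, up to sign, a product over the gaps `(t_r, t_{r+1})` of `j` of iterated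
integrals along `p_r` of the forms `dz / (z - a_s(x))`, where `s` runs over the places of the ones
of `i` in the gap (`entry_eq_prod`).

The heart of the matter is the differential of one such integral, from `b_0` to `b_{m+1}` with the
poles `b_1, …, b_m`, along a `C²` family of paths: it is the sum over `s` of the integral without
the `s`-th form times `d log ((b_{s+1} - b_s) / (b_{s-1} - b_s))`
(`IsVariation.hasFDerivAt_seqInt_one`). More generally, a formula of this shape holds for the integral
up to time `t`. It follows by induction on the number of forms: the differential of the integrand is
the time derivative of the claimed formula, because the mixed second derivatives of the path agree
and because `dz / (z - b)` for two poles satisfy a three-term relation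
(`IsVariation.pulledForm_mul_dlogSub`). The paths depend on `x` only smoothly in the real sense, but
the result is complex linear, so the entries are holomorphic. The product rule now yields
`dE_{i,j} = ∑_k E_{k,j} ω_{i,k}` (`hasFDerivAt_entry`), since leaving out a place of a one of `i`
that is not a one of `j` changes one factor only (`entry_dropAt`).

The matrix is triangular for `⊆` with diagonal entries `(2πi)^{|j|}`, hence invertible, and a solution
that vanishes at one point of a connected set vanishes by induction on the weight
(`IsSolution.eq_zero`). This makes the columns a fundamental system.

The entries of `ω` are closed since they are locally differentials of logarithms
(`exists_primitive_omega`). That `ω ∧ ω = 0` needs no computation: the second differentials of the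
columns are symmetric and the columns span (`omegaAt_comm`). For three consecutive places the
ratio in the definition of `ω` is a product of powers of coordinates and of factors
`1 - x_s ⋯ x_t` (`isIntegralComb_dlog_ratio`). In a chart of projective space these become
quotients of factors of the equation of the divisor, and a logarithmic differential of a factor of
`h` times `h` is holomorphic (`ExtendsMul.dlog_factor`).

Paths exist because some parabolic arc misses finitely many points (`exists_path_avoiding`); a given
choice of paths is carried to nearby points by adding to each path the affine interpolation of the
displacement of its end points (`exists_isPathFamily`).
-/

noncomputable section

namespace MultiLog

/-! ### Places of the ones of an index -/

section Place

variable {n : ℕ}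

@[simp] theorem place_zero (i : Idx n) : place i 0 = 0 := rfl

theorem place_succ (i : Idx n) {r : ℕ} (h : r < i.card) :
    place i (r + 1) = (i.orderEmbOfFin rfl ⟨r, h⟩ : ℕ) + 1 := by
  simp [place, h]

@[simp] theorem place_card_succ (i : Idx n) : place i (i.card + 1) = n + 1 := by
  simp [place]

theorem place_lt_succ (i : Idx n) {r : ℕ} (h : r ≤ i.card) : place i r < place i (r + 1) := by
  rcases h.lt_or_eq with h | rfl
  · rw [place_succ i h]
    match r with
    | 0 => simp
    | r + 1 =>
      rw [place_succ i (by omega)]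
      have : i.orderEmbOfFin rfl ⟨r, by omega⟩ < i.orderEmbOfFin rfl ⟨r + 1, h⟩ :=
        (i.orderEmbOfFin rfl).strictMono (by simp)
      have := Fin.lt_def.1 this
      omega
  · rw [place_card_succ]
    match h0 : i.card with
    | 0 => simp
    | r + 1 =>
      rw [place_succ i (by omega)]
      omega

theorem place_lt (i : Idx n) {r s : ℕ} (h : r < s) (hs : s ≤ i.card + 1) :
    place i r < place i s := by
  induction s, h using Nat.le_induction with
  | base => exact place_lt_succ i (by omega)
  | succ s _ ih => exact (ih (by omega)).trans (place_lt_succ i (by omega))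

theorem place_le (i : Idx n) {r s : ℕ} (h : r ≤ s) (hs : s ≤ i.card + 1) :
    place i r ≤ place i s := by
  rcases h.lt_or_eq with h | rfl
  · exact (place_lt i h hs).le
  · rfl

theorem place_lt_iff (i : Idx n) {r s : ℕ} (hr : r ≤ i.card + 1) (hs : s ≤ i.card + 1) :
    place i r < place i s ↔ r < s :=
  ⟨fun h => by by_contra! h'; exact absurd h (place_le i h' hr).not_gt, fun h => place_lt i h hs⟩

theorem place_inj (i : Idx n) {r s : ℕ} (hr : r ≤ i.card + 1) (hs : s ≤ i.card + 1) :
    place i r = place i s ↔ r = s := by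
  refine ⟨fun h => ?_, fun h => h ▸ rfl⟩
  rcases lt_trichotomy r s with h' | h' | h'
  · exact absurd h (place_lt i h' hs).ne
  · exact h'
  · exact absurd h (place_lt i h' hr).ne'

theorem place_le_last (i : Idx n) {r : ℕ} (hr : r ≤ i.card + 1) : place i r ≤ n + 1 :=
  (place_le i hr le_rfl).trans (place_card_succ i).le

theorem exists_mem_place (i : Idx n) {r : ℕ} (h1 : 1 ≤ r) (h2 : r ≤ i.card) :
    ∃ α ∈ i, place i r = (α : ℕ) + 1 := by
  obtain ⟨r, rfl⟩ := Nat.exists_eq_add_of_le' h1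
  exact ⟨i.orderEmbOfFin rfl ⟨r, h2⟩, orderEmbOfFin_mem _ _ _, place_succ i h2⟩

theorem exists_place_of_mem {i : Idx n} {α : Fin n} (h : α ∈ i) :
    ∃ r, 1 ≤ r ∧ r ≤ i.card ∧ place i r = (α : ℕ) + 1 := by
  have : α ∈ Set.range (i.orderEmbOfFin rfl) := by simpa using h
  obtain ⟨r, rfl⟩ := this
  exact ⟨r + 1, by omega, r.2, place_succ i r.2⟩

/-- The function `place j` is the only increasing enumeration of the ones of `j`, with the
conventional values `0` and `n + 1` at the ends. -/
theorem place_unique (j : Idx n) (f : ℕ → ℕ) (h0 : f 0 = 0) (h1 : f (j.card + 1) = n + 1)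
    (hlt : ∀ r ≤ j.card, f r < f (r + 1))
    (hmem : ∀ r, 1 ≤ r → r ≤ j.card → ∃ α ∈ j, f r = (α : ℕ) + 1) {r : ℕ}
    (hr : r ≤ j.card + 1) : place j r = f r := by
  rcases Nat.eq_zero_or_pos r with rfl | hr0
  · rw [h0, place_zero]
  rcases hr.lt_or_eq with hr | rfl
  swap
  · rw [h1, place_card_succ]
  choose g hg hfg using fun r : Fin j.card => hmem (r + 1) (by omega) (by omega)
  have hmono : ∀ a b : ℕ, a < b → b ≤ j.card → f a < f b := by
    intro a b hab hb
    induction b, hab using Nat.le_induction with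
    | base => exact hlt a (by omega)
    | succ s _ ih => exact (ih (by omega)).trans (hlt s (by omega))
  have hg' : StrictMono g := by
    intro a b hab
    have := hmono (a + 1) (b + 1) (by simpa using hab) b.2
    rw [hfg, hfg] at this
    exact Fin.lt_def.2 (by omega)
  obtain ⟨r, rfl⟩ := Nat.exists_eq_add_of_le' hr0
  have := orderEmbOfFin_unique (s := j) rfl hg hg'
  rw [place_succ j (by omega), ← this]
  exact (hfg ⟨r, by omega⟩).symm

theorem card_retract {i j : Idx n} (h : j ⊆ i) : (retract i j).card = j.card := by
  have : (retract i j).map (i.orderEmbOfFin rfl).toEmbedding = j := by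
    ext α
    simp only [retract, mem_map, mem_filter, mem_univ, true_and]
    constructor
    · rintro ⟨m, hm, rfl⟩; exact hm
    · intro hα
      have : α ∈ Set.range (i.orderEmbOfFin rfl) := by simpa using h hα
      obtain ⟨m, rfl⟩ := this
      exact ⟨m, hα, rfl⟩
  rw [← this, card_map, this]

/-- The one number `r` of `j ⊆ i` is the one number `place (retract i j) r` of `i`. -/
theorem place_retract {i j : Idx n} (h : j ⊆ i) {r : ℕ} (hr : r ≤ j.card + 1) :
    place i (place (retract i j) r) = place j r := by
  have hc := card_retract h
  refine (place_unique j (fun r => place i (place (retract i j) r)) rfl ?_ ?_ ?_ hr).symm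
  · rw [← hc, place_card_succ, place_card_succ]
  · intro r hr
    exact place_lt i (place_lt_succ _ (by omega)) (place_le_last _ (by omega))
  · intro r h1 h2
    obtain ⟨m, hm, h⟩ := exists_mem_place (retract i j) h1 (by omega)
    refine ⟨i.orderEmbOfFin rfl m, by simpa [retract] using hm, ?_⟩
    simp only [h]
    exact place_succ i m.2

/-- The points `a_q` of `x(i)` are the points `a_s` of `x` at the places `s` of the ones of `i`. -/
theorem a_sub (i : Idx n) (x : Pt n) {q : ℕ} (hq : q ≤ i.card + 1) :
    a (sub i x) q = a x (place i q) := by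
  suffices h : ∀ q, 1 ≤ q → q ≤ i.card + 1 →
      ∏ m ∈ univ.filter (fun m : Fin i.card => q ≤ (m : ℕ) + 1), sub i x m =
        ∏ α ∈ univ.filter (fun α : Fin n => place i q ≤ (α : ℕ) + 1), x α by
    rcases Nat.eq_zero_or_pos q with rfl | h0
    · simp [a]
    · have := place_lt i h0 hq
      rw [place_zero] at this
      rw [a, a, if_neg h0.ne', if_neg this.ne', h q h0 hq]
  intro q h1 h2
  induction h2 using Nat.decreasingInduction with
  | self =>
    rw [place_card_succ, filter_false_of_mem, filter_false_of_mem]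
    · simp
    · intro α _; omega
    · intro m _; omega
  | of_succ q hq ih =>
    obtain ⟨q, rfl⟩ := Nat.exists_eq_add_of_le' h1
    have e1 : univ.filter (fun m : Fin i.card => q + 1 ≤ (m : ℕ) + 1) =
        insert ⟨q, by omega⟩ (univ.filter fun m : Fin i.card => q + 1 + 1 ≤ (m : ℕ) + 1) := by
      ext m
      simp only [mem_filter, mem_univ, true_and, mem_insert, Fin.ext_iff]
      omega
    have hlt := place_lt_succ i (r := q + 1) (by omega)
    have e2 : univ.filter (fun α : Fin n => place i (q + 1) ≤ (α : ℕ) + 1) =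
        univ.filter (fun α : Fin n => place i (q + 1) ≤ (α : ℕ) + 1 ∧
          (α : ℕ) + 1 < place i (q + 1 + 1)) ∪
        univ.filter (fun α : Fin n => place i (q + 1 + 1) ≤ (α : ℕ) + 1) := by
      ext m
      simp only [mem_filter, mem_univ, true_and, mem_union]
      omega
    rw [e1, prod_insert (by simp), ih (by omega), e2, prod_union]
    · rfl
    · rw [disjoint_filter]
      intro α _ h
      omega

/-- The index `i` without its one number `s`. -/
def dropAt (i : Idx n) (s : ℕ) : Idx n := i.filter fun α => (α : ℕ) + 1 ≠ place i s

theorem dropAt_subset (i : Idx n) (s : ℕ) : dropAt i s ⊆ i := filter_subset _ _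

theorem dropAt_eq_erase {i : Idx n} {s : ℕ} {α : Fin n} (h : place i s = (α : ℕ) + 1) :
    dropAt i s = i.erase α := by
  ext β
  simp [dropAt, h, Fin.ext_iff, and_comm]

theorem card_dropAt {i : Idx n} {s : ℕ} (h1 : 1 ≤ s) (h2 : s ≤ i.card) :
    (dropAt i s).card + 1 = i.card := by
  obtain ⟨α, hα, h⟩ := exists_mem_place i h1 h2
  rw [dropAt_eq_erase h, card_erase_add_one hα]

theorem exists_eq_dropAt {i k : Idx n} (h : k ⊆ i) (hc : k.card + 1 = i.card) :
    ∃ s, 1 ≤ s ∧ s ≤ i.card ∧ k = dropAt i s := by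
  obtain ⟨α, hα, rfl⟩ : ∃ α ∈ i, k = i.erase α := by
    have : (i \ k).card = 1 := by rw [card_sdiff_of_subset h]; omega
    obtain ⟨α, hα⟩ := card_eq_one.1 this
    have hm : α ∈ i \ k := by simp [hα]
    rw [mem_sdiff] at hm
    refine ⟨α, hm.1, eq_of_subset_of_card_le (fun β hβ => mem_erase.2 ⟨?_, h hβ⟩) ?_⟩
    · rintro rfl; exact hm.2 hβ
    · rw [card_erase_of_mem hm.1]; omega
  obtain ⟨s, h1, h2, h3⟩ := exists_place_of_mem hα
  exact ⟨s, h1, h2, (dropAt_eq_erase h3).symm⟩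

theorem dropAt_injOn {i : Idx n} {s s' : ℕ} (h1 : 1 ≤ s) (h2 : s ≤ i.card) (h2' : s' ≤ i.card)
    (h : dropAt i s = dropAt i s') : s = s' := by
  obtain ⟨α, hα, hs⟩ := exists_mem_place i h1 h2
  have : α ∉ dropAt i s' := by rw [← h]; simp [dropAt, hs]
  simp only [dropAt, mem_filter, hα, true_and, not_not] at this
  exact (place_inj i (by omega) (by omega)).1 (hs.trans this)

theorem place_dropAt {i : Idx n} {s : ℕ} (h1 : 1 ≤ s) (h2 : s ≤ i.card) {q : ℕ}
    (hq : q ≤ i.card) : place (dropAt i s) q = place i (if q < s then q else q + 1) := by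
  have hc := card_dropAt h1 h2
  refine place_unique (dropAt i s) (fun q => place i (if q < s then q else q + 1)) ?_ ?_ ?_ ?_
    (hq.trans hc.ge)
  · simp [show 0 < s by omega]
  · simp [hc, show ¬ i.card < s by omega]
  · intro r hr
    refine place_lt i ?_ ?_ <;> (split_ifs <;> omega)
  · intro r hr1 hr2
    obtain ⟨α, hα, h⟩ := exists_mem_place i (r := if r < s then r else r + 1)
      (by split_ifs <;> omega) (by split_ifs <;> omega)
    refine ⟨α, ?_, h⟩
    rw [dropAt, mem_filter]
    refine ⟨hα, ?_⟩
    rw [← h, Ne, place_inj i (by split_ifs <;> omega) (by omega)]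
    split_ifs <;> omega

theorem place_retract_ne {i j : Idx n} {s : ℕ} (h1 : 1 ≤ s) (h2 : s ≤ i.card)
    (h : j ⊆ dropAt i s) {r : ℕ} (hr : r ≤ j.card + 1) : place (retract i j) r ≠ s := by
  have hji := h.trans (dropAt_subset i s)
  have hc := card_retract hji
  intro hrs
  have hp := place_retract hji hr
  rw [hrs] at hp
  have h0 : r ≠ 0 := by rintro rfl; simp at hrs; omega
  have hl : r ≠ j.card + 1 := by
    rintro rfl
    rw [← hc, place_card_succ] at hrs
    omega
  obtain ⟨α, hα, hj⟩ := exists_mem_place j (r := r) (by omega) (by omega)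
  have := h hα
  simp only [dropAt, mem_filter] at this
  exact this.2 (by rw [hp, hj])

theorem place_retract_dropAt {i j : Idx n} {s : ℕ} (h1 : 1 ≤ s) (h2 : s ≤ i.card)
    (h : j ⊆ dropAt i s) {r : ℕ} (hr : r ≤ j.card + 1) :
    place (retract (dropAt i s) j) r =
      if place (retract i j) r < s then place (retract i j) r else place (retract i j) r - 1 := by
  have hji := h.trans (dropAt_subset i s)
  have hne := place_retract_ne h1 h2 h hr
  have hc := card_dropAt h1 h2
  have hle : place (retract i j) r ≤ i.card + 1 :=
    place_le_last _ (by rw [card_retract hji]; exact hr)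
  have hle' : place (retract (dropAt i s) j) r ≤ (dropAt i s).card + 1 :=
    place_le_last _ (by rw [card_retract h]; exact hr)
  refine (place_inj (dropAt i s) hle' (by split_ifs <;> omega)).1 ?_
  rw [place_retract h hr, place_dropAt h1 h2 (by split_ifs <;> omega), ← place_retract hji hr]
  congr 1
  split_ifs <;> omega

theorem subset_dropAt {i j : Idx n} (hji : j ⊆ i) {s : ℕ} (h2 : s ≤ i.card)
    (h : ∀ r, 1 ≤ r → r ≤ j.card → place (retract i j) r ≠ s) : j ⊆ dropAt i s := by
  intro α hα
  rw [dropAt, mem_filter]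
  refine ⟨hji hα, fun hs => ?_⟩
  obtain ⟨r, hr1, hr2, hr⟩ := exists_place_of_mem hα
  refine h r hr1 hr2 ((place_inj i ?_ (by omega)).1 ?_)
  · exact place_le_last _ (by rw [card_retract hji]; omega)
  · rw [place_retract hji (by omega), hr, hs]

/-- A number between `0` and `n + 1` which is not a place of a one lies between two consecutive
places. -/
theorem exists_place_lt (j : Idx n) {s : ℕ} (h1 : 1 ≤ s) (h2 : s ≤ n)
    (h : ∀ r ≤ j.card + 1, place j r ≠ s) : ∃ r ≤ j.card, place j r < s ∧ s < place j (r + 1) := by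
  by_contra! hcon
  have : ∀ r ≤ j.card + 1, place j r < s := by
    intro r hr
    induction r with
    | zero => exact h1
    | succ r ih => exact lt_of_le_of_ne (hcon r (by omega) (ih (by omega))) (h _ hr)
  have := this _ le_rfl
  rw [place_card_succ] at this
  omega

end Place

/-! ### Iterated integrals along a family of paths -/

section IteratedIntegral

open Set Filter Topology

/-- The iterated integral `iterInt` of the first `m` terms of a sequence of functions. -/
def seqInt (w : ℕ → ℝ → ℂ) : ℕ → ℝ → ℂ
  | 0, _ => 1
  | m + 1, t => ∫ u in (0 : ℝ)..t, seqInt w m u * w m u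

/-- The sequence `w` with its `s`-th term left out. -/
def skip {α : Type*} (s : ℕ) (w : ℕ → α) (q : ℕ) : α := if q < s then w q else w (q + 1)

theorem iterInt_eq_seqInt (w : ℕ → ℝ → ℂ) (m : ℕ) (t : ℝ) :
    iterInt m (fun q => w q) t = seqInt w m t := by
  induction m generalizing t with
  | zero => rfl
  | succ m ih =>
    simp only [iterInt, seqInt]
    refine intervalIntegral.integral_congr fun u _ => ?_
    simp only [Fin.val_last]
    rw [← ih u]
    rfl

theorem seqInt_congr {w w' : ℕ → ℝ → ℂ} {m : ℕ} {t : ℝ} (ht : t ∈ Icc (0 : ℝ) 1)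
    (h : ∀ q < m, ∀ u ∈ Icc (0 : ℝ) 1, w q u = w' q u) : seqInt w m t = seqInt w' m t := by
  induction m generalizing t with
  | zero => rfl
  | succ m ih =>
    simp only [seqInt]
    refine intervalIntegral.integral_congr fun u hu => ?_
    rw [uIcc_of_le ht.1] at hu
    have hu' : u ∈ Icc (0 : ℝ) 1 := ⟨hu.1, hu.2.trans ht.2⟩
    rw [ih hu' fun q hq => h q (by omega), h m (by omega) u hu']

theorem seqInt_skip_self {w : ℕ → ℝ → ℂ} {m : ℕ} {t : ℝ} (ht : t ∈ Icc (0 : ℝ) 1) :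
    seqInt (skip m w) m t = seqInt w m t :=
  seqInt_congr ht fun q hq u _ => by simp [skip, hq]

variable {X : Type*} [TopologicalSpace X]
  {F : Type*} [NormedAddCommGroup F] {E : Type*} [NormedAddCommGroup E] [NormedSpace ℝ E]

theorem continuousOn_integral_param [FirstCountableTopology X] {U : Set X} {G : X → ℝ → ℂ}
    (hG : ContinuousOn (fun z : X × ℝ => G z.1 z.2) (U ×ˢ Icc (0 : ℝ) 1)) :
    ContinuousOn (fun z : X × ℝ => ∫ u in (0 : ℝ)..z.2, G z.1 u) (U ×ˢ Icc (0 : ℝ) 1) := by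
  -- the integrand is made continuous on `U × ℝ` by projecting the variable to `[0,1]`
  rw [continuousOn_iff_continuous_domRestrict]
  let f : (U ×ˢ Icc (0 : ℝ) 1 : Set (X × ℝ)) → ℝ → ℂ := fun z u =>
    G z.1.1 (projIcc (0 : ℝ) 1 zero_le_one u)
  have hf : Continuous (Function.uncurry f) := by
    refine hG.comp_continuous (f := fun z : (U ×ˢ Icc (0 : ℝ) 1 : Set (X × ℝ)) × ℝ =>
      ((z.1.1.1, (projIcc (0 : ℝ) 1 zero_le_one z.2 : ℝ)) : X × ℝ)) ?_ ?_
    · fun_prop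
    · exact fun z => ⟨z.1.2.1, Subtype.coe_prop _⟩
  have := intervalIntegral.continuous_parametric_intervalIntegral_of_continuous (a₀ := (0 : ℝ))
    (μ := MeasureTheory.volume) hf
    (s := fun z : (U ×ˢ Icc (0 : ℝ) 1 : Set (X × ℝ)) => z.1.2) (by fun_prop)
  refine this.congr fun z => ?_
  refine intervalIntegral.integral_congr fun u hu => ?_
  rw [uIcc_of_le z.2.2.1] at hu
  simp only [f]
  rw [projIcc_of_mem zero_le_one (⟨hu.1, hu.2.trans z.2.2.2⟩ : u ∈ Icc (0 : ℝ) 1)]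

theorem continuousOn_seqInt [FirstCountableTopology X] {U : Set X} {w : ℕ → X → ℝ → ℂ} {m : ℕ}
    (hw : ∀ q < m, ContinuousOn (fun z : X × ℝ => w q z.1 z.2) (U ×ˢ Icc (0 : ℝ) 1)) :
    ContinuousOn (fun z : X × ℝ => seqInt (fun q => w q z.1) m z.2) (U ×ˢ Icc (0 : ℝ) 1) := by
  induction m with
  | zero => exact continuousOn_const
  | succ m ih =>
    exact continuousOn_integral_param (G := fun x u => seqInt (fun q => w q x) m u * w m x u)
      ((ih fun q hq => hw q (by omega)).mul (hw m (by omega)))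

theorem continuousOn_slice {Y : Type*} [TopologicalSpace Y] {U : Set X} {I : Set ℝ}
    {G : X → ℝ → Y} (hG : ContinuousOn (fun z : X × ℝ => G z.1 z.2) (U ×ˢ I)) {x : X}
    (hx : x ∈ U) : ContinuousOn (G x) I :=
  hG.comp (f := fun u => (x, u)) (by fun_prop) fun _ hu => ⟨hx, hu⟩

theorem eventually_forall_mem_of_continuousOn {Y : Type*} [TopologicalSpace Y] {U : Set X}
    (hU : IsOpen U) {W : Set Y} (hW : IsOpen W) {G : X → ℝ → Y}
    (hG : ContinuousOn (fun z : X × ℝ => G z.1 z.2) (U ×ˢ Icc (0 : ℝ) 1)) {x : X} (hx : x ∈ U)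
    (h : ∀ u ∈ Icc (0 : ℝ) 1, G x u ∈ W) : ∀ᶠ y in 𝓝 x, ∀ u ∈ Icc (0 : ℝ) 1, G y u ∈ W := by
  have := isCompact_Icc.eventually_forall_of_forall_eventually (x₀ := x) (K := Icc (0 : ℝ) 1)
    (P := fun y u => u ∈ Icc (0 : ℝ) 1 → G y u ∈ W) ?_
  · filter_upwards [this] with y hy u hu using hy u hu hu
  · intro u hu
    have h1 := (hG (x, u) ⟨hx, hu⟩).eventually (hW.eventually_mem (h u hu))
    rw [eventually_nhdsWithin_iff] at h1
    have h2 : ∀ᶠ z : X × ℝ in 𝓝 (x, u), z.1 ∈ U :=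
      continuous_fst.continuousAt.eventually (hU.mem_nhds hx)
    filter_upwards [h1, h2] with z hz hz' hz'' using hz ⟨hz', hz''⟩

theorem eventually_norm_lt_of_continuousOn {U : Set X} (hU : IsOpen U) {G : X → ℝ → F}
    (hG : ContinuousOn (fun z : X × ℝ => G z.1 z.2) (U ×ˢ Icc (0 : ℝ) 1)) {x : X} (hx : x ∈ U) :
    ∃ C : ℝ, ∀ᶠ y in 𝓝 x, ∀ u ∈ Icc (0 : ℝ) 1, ‖G y u‖ < C := by
  obtain ⟨C, hC⟩ := isCompact_Icc.exists_bound_of_continuousOn (continuousOn_slice hG hx)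
  exact ⟨C + 1, eventually_forall_mem_of_continuousOn hU
    (isOpen_lt continuous_norm continuous_const) hG hx
    fun u hu => (hC u hu).trans_lt (lt_add_one C)⟩

theorem hasFDerivAt_integral_param {U : Set E} (hU : IsOpen U) {G : E → ℝ → ℂ}
    {G' : E → ℝ → E →L[ℝ] ℂ}
    (hG : ContinuousOn (fun z : E × ℝ => G z.1 z.2) (U ×ˢ Icc (0 : ℝ) 1))
    (hG' : ContinuousOn (fun z : E × ℝ => G' z.1 z.2) (U ×ˢ Icc (0 : ℝ) 1))
    (hd : ∀ x ∈ U, ∀ u ∈ Ioo (0 : ℝ) 1, HasFDerivAt (fun y => G y u) (G' x u) x)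
    {x : E} (hx : x ∈ U) {t : ℝ} (ht : t ∈ Icc (0 : ℝ) 1) :
    HasFDerivAt (fun y => ∫ u in (0 : ℝ)..t, G y u) (∫ u in (0 : ℝ)..t, G' x u) x := by
  obtain ⟨C, hC⟩ := eventually_norm_lt_of_continuousOn hU hG' hx
  have hN : {y | y ∈ U ∧ ∀ u ∈ Icc (0 : ℝ) 1, ‖G' y u‖ < C} ∈ 𝓝 x :=
    (hU.eventually_mem hx).and hC
  have hsub : uIcc 0 t ⊆ Icc (0 : ℝ) 1 := by
    rw [uIcc_of_le ht.1]; exact Icc_subset_Icc_right ht.2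
  have hint : ∀ {y}, y ∈ U → IntervalIntegrable (G y) MeasureTheory.volume 0 t :=
    fun hy => ((continuousOn_slice hG hy).mono hsub).intervalIntegrable
  have hint' : IntervalIntegrable (G' x) MeasureTheory.volume 0 t :=
    ((continuousOn_slice hG' hx).mono hsub).intervalIntegrable
  refine intervalIntegral.hasFDerivAt_integral_of_dominated_of_fderiv_le (bound := fun _ => C) hN
    ?_ (hint hx) (intervalIntegrable_iff.1 hint').aestronglyMeasurable
    ?_ (by simp) ?_
  · filter_upwards [hU.eventually_mem hx] with y hy
    exact (intervalIntegrable_iff.1 (hint hy)).aestronglyMeasurable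
  · refine Eventually.of_forall fun u hu y hy => (hy.2 u ?_).le
    exact hsub (uIoc_subset_uIcc hu)
  · have h1 : ∀ᵐ u : ℝ, u ≠ 1 := by
      simp [MeasureTheory.ae_iff]
    filter_upwards [h1] with u hu1 hu y hy
    rw [uIoc_of_le ht.1] at hu
    exact hd y hy.1 u ⟨hu.1, lt_of_le_of_ne (hu.2.trans ht.2) hu1⟩

/-- The partial derivatives of a `C²` family of paths `P`: the velocity `Pt`, the variation `dP`
with the parameter, and the mixed second derivative `dPt`, which is the derivative of either. -/
structure HasPartials (U : Set E) (P Pt : E → ℝ → ℂ) (dP dPt : E → ℝ → E →L[ℝ] ℂ) : Prop where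
  cont : ContinuousOn (fun z : E × ℝ => P z.1 z.2) (U ×ˢ Icc (0 : ℝ) 1)
  cont_t : ContinuousOn (fun z : E × ℝ => Pt z.1 z.2) (U ×ˢ Icc (0 : ℝ) 1)
  cont_x : ContinuousOn (fun z : E × ℝ => dP z.1 z.2) (U ×ˢ Icc (0 : ℝ) 1)
  cont_tx : ContinuousOn (fun z : E × ℝ => dPt z.1 z.2) (U ×ˢ Icc (0 : ℝ) 1)
  deriv_x : ∀ x ∈ U, ∀ t ∈ Icc (0 : ℝ) 1, HasFDerivAt (fun y => P y t) (dP x t) x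
  derivWithin_t : ∀ x ∈ U, ∀ t ∈ Icc (0 : ℝ) 1, derivWithin (P x) (Icc 0 1) t = Pt x t
  deriv_t : ∀ x ∈ U, ∀ t ∈ Ioo (0 : ℝ) 1, HasDerivAt (P x) (Pt x t) t
  deriv_tx : ∀ x ∈ U, ∀ t ∈ Ioo (0 : ℝ) 1, HasFDerivAt (fun y => Pt y t) (dPt x t) x
  deriv_xt : ∀ x ∈ U, ∀ t ∈ Ioo (0 : ℝ) 1, HasDerivAt (dP x) (dPt x t) t

theorem exists_hasPartials {U : Set E} (hU : IsOpen U) {P : E → ℝ → ℂ}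
    (hP : ContDiffOn ℝ 2 (fun z : E × ℝ => P z.1 z.2) (U ×ˢ Icc (0 : ℝ) 1)) :
    ∃ Pt dP dPt, HasPartials U P Pt dP dPt := by
  set s : Set (E × ℝ) := U ×ˢ Icc (0 : ℝ) 1 with hs
  set f : E × ℝ → ℂ := fun z => P z.1 z.2 with hf
  have hu : UniqueDiffOn ℝ s := hU.uniqueDiffOn.prod (uniqueDiffOn_Icc zero_lt_one)
  set f' := fderivWithin ℝ f s with hf'
  set f'' := fderivWithin ℝ f' s with hf''
  have hc1 : ContDiffOn ℝ 1 f' s := hP.fderivWithin hu (by norm_num)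
  have hc0 : ContinuousOn f'' s := hc1.continuousOn_fderivWithin hu le_rfl
  have hd : ∀ z ∈ s, HasFDerivWithinAt f (f' z) s z := fun z hz =>
    ((hP z hz).differentiableWithinAt (by norm_num)).hasFDerivWithinAt
  have hd' : ∀ z ∈ s, HasFDerivWithinAt f' (f'' z) s z := fun z hz =>
    ((hc1 z hz).differentiableWithinAt (by norm_num)).hasFDerivWithinAt
  have hint : ∀ x ∈ U, ∀ t ∈ Ioo (0 : ℝ) 1, s ∈ 𝓝 (x, t) := fun x hx t ht =>
    prod_mem_nhds (hU.mem_nhds hx) (Icc_mem_nhds ht.1 ht.2)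
  have hss : ∀ {x t}, x ∈ U → t ∈ Ioo (0 : ℝ) 1 → (x, t) ∈ s := fun hx ht =>
    ⟨hx, Ioo_subset_Icc_self ht⟩
  have hsymm : ∀ x ∈ U, ∀ t ∈ Ioo (0 : ℝ) 1, ∀ v w, f'' (x, t) v w = f'' (x, t) w v := by
    intro x hx t ht v w
    refine ((hP (x, t) (hss hx ht)).isSymmSndFDerivWithinAt (by simp) hu
      (subset_closure ?_) (hss hx ht)).eq v w
    exact mem_interior_iff_mem_nhds.2 (hint x hx t ht)
  have hinl : ∀ (x : E) (t : ℝ), HasFDerivAt (fun y : E => (y, t))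
      (ContinuousLinearMap.inl ℝ E ℝ) x := fun x t => hasFDerivAt_prodMk_left x t
  have hinr : ∀ (x : E) (t : ℝ), HasDerivAt (fun u : ℝ => (x, u)) ((0 : E), (1 : ℝ)) t :=
    fun x t => (hasDerivAt_const t x).prodMk (hasDerivAt_id t)
  obtain ⟨ev, hev⟩ : ∃ ev : (E × ℝ →L[ℝ] ℂ) →L[ℝ] ℂ, ∀ L, ev L = L (0, 1) :=
    ⟨ContinuousLinearMap.apply ℝ ℂ ((0 : E), (1 : ℝ)), fun _ => rfl⟩
  obtain ⟨res, hres⟩ : ∃ res : (E × ℝ →L[ℝ] ℂ) →L[ℝ] (E →L[ℝ] ℂ),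
      ∀ L, res L = L.comp (ContinuousLinearMap.inl ℝ E ℝ) :=
    ⟨(ContinuousLinearMap.compL ℝ E (E × ℝ) ℂ).flip (ContinuousLinearMap.inl ℝ E ℝ), fun _ => rfl⟩
  refine ⟨fun x t => ev (f' (x, t)), fun x t => res (f' (x, t)),
    fun x t => res (f'' (x, t) ((0 : E), (1 : ℝ))), ?_⟩
  have hdt : ∀ x ∈ U, ∀ t ∈ Icc (0 : ℝ) 1,
      HasDerivWithinAt (P x) (ev (f' (x, t))) (Icc 0 1) t := by
    intro x hx t ht
    have := (hd (x, t) ⟨hx, ht⟩).comp_hasDerivWithinAt t (hinr x t).hasDerivWithinAt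
      (fun u hu => (⟨hx, hu⟩ : (x, u) ∈ s))
    rw [hev]
    exact this
  refine ⟨hP.continuousOn, ev.continuous.comp_continuousOn hc1.continuousOn,
    res.continuous.comp_continuousOn hc1.continuousOn, ?_, ?_, ?_, ?_, ?_, ?_⟩
  · exact res.continuous.comp_continuousOn (hc0.clm_apply continuousOn_const)
  · intro x hx t ht
    have := (hd (x, t) ⟨hx, ht⟩).comp (t := s) (s := U) (f := fun y : E => (y, t)) x
      (hinl x t).hasFDerivWithinAt (fun y hy => ⟨hy, ht⟩)
    rw [hres]
    exact this.hasFDerivAt (hU.mem_nhds hx)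
  · intro x hx t ht
    exact (hdt x hx t ht).derivWithin (uniqueDiffOn_Icc zero_lt_one t ht)
  · intro x hx t ht
    exact (hdt x hx t (Ioo_subset_Icc_self ht)).hasDerivAt (Icc_mem_nhds ht.1 ht.2)
  · intro x hx t ht
    have h1 := ((hd' (x, t) (hss hx ht)).hasFDerivAt (hint x hx t ht)).comp x (hinl x t)
    have h2 := ev.hasFDerivAt.comp x h1
    refine h2.congr_fderiv ?_
    ext v
    simp only [ContinuousLinearMap.comp_apply, hev, hres]
    exact hsymm x hx t ht (v, 0) (0, 1)
  · intro x hx t ht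
    have h1 := ((hd' (x, t) (hss hx ht)).hasFDerivAt (hint x hx t ht)).comp_hasDerivAt t (hinr x t)
    exact res.hasFDerivAt.comp_hasDerivAt t h1


variable {E : Type*} [NormedAddCommGroup E] [NormedSpace ℝ E]

/-- The logarithmic derivative `(df - dg) / (f - g)` of a difference of two functions with the
values `f`, `g` and the differentials `df`, `dg`. -/
def dlogSub (f g : ℂ) (df dg : E →L[ℝ] ℂ) : E →L[ℝ] ℂ := (f - g)⁻¹ • (df - dg)

/-- `d log ((b_{s+2} - b_{s+1}) / (b_s - b_{s+1}))`. -/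
def dlogRatio (b : ℕ → E → ℂ) (db : ℕ → E → E →L[ℝ] ℂ) (s : ℕ) (x : E) : E →L[ℝ] ℂ :=
  dlogSub (b (s + 2) x) (b (s + 1) x) (db (s + 2) x) (db (s + 1) x) -
    dlogSub (b s x) (b (s + 1) x) (db s x) (db (s + 1) x)

/-- The pull-back of `dz / (z - b_{q+1})` along the path `P x` with the velocity `Pt x`. -/
def pulledForm (P Pt : E → ℝ → ℂ) (b : ℕ → E → ℂ) (q : ℕ) (x : E) (t : ℝ) : ℂ :=
  Pt x t / (P x t - b (q + 1) x)

/-- The differential with respect to `x` of the `m`-fold iterated integral up to time `t`: a sum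
over the forms that may be left out. In the last summand the end point `P x t` takes the place of
the pole that would come next. -/
def seqIntDeriv (P Pt : E → ℝ → ℂ) (dP : E → ℝ → E →L[ℝ] ℂ) (b : ℕ → E → ℂ)
    (db : ℕ → E → E →L[ℝ] ℂ) : ℕ → E → ℝ → E →L[ℝ] ℂ
  | 0, _, _ => 0
  | m + 1, x, t =>
    ∑ s ∈ Finset.range m,
        seqInt (skip s fun q => pulledForm P Pt b q x) m t • dlogRatio b db s x +
      seqInt (fun q => pulledForm P Pt b q x) m t •
        (dlogSub (P x t) (b (m + 1) x) (dP x t) (db (m + 1) x) -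
          dlogSub (b m x) (b (m + 1) x) (db m x) (db (m + 1) x))

theorem skip_apply {α β : Type*} (s : ℕ) (w : ℕ → α → β) (x : α) :
    (fun q => skip s w q x) = skip s fun q => w q x := by
  funext q; simp only [skip]; split <;> rfl

theorem hasDerivAt_seqInt {w : ℕ → ℝ → ℂ} {m : ℕ}
    (hw : ∀ q ≤ m, ContinuousOn (w q) (Icc 0 1)) {t : ℝ} (ht : t ∈ Ioo (0 : ℝ) 1) :
    HasDerivAt (seqInt w (m + 1)) (seqInt w m t * w m t) t := by
  have hN : ContinuousOn (seqInt w m) (Icc 0 1) :=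
    continuousOn_slice (G := fun _ : Unit => seqInt w m)
      (continuousOn_seqInt (U := univ) (w := fun q _ => w q)
        fun q hq => (hw q hq.le).comp (by fun_prop) fun z hz => hz.2) (Set.mem_univ ())
  have hc : ContinuousOn (fun u => seqInt w m u * w m u) (Icc 0 1) := hN.mul (hw m le_rfl)
  have hI : Icc (0 : ℝ) 1 ∈ 𝓝 t := Icc_mem_nhds ht.1 ht.2
  refine intervalIntegral.integral_hasDerivAt_right
    ((hc.mono ?_).intervalIntegrable) ?_ (hc.continuousAt hI)
  · rw [uIcc_of_le ht.1.le]; exact Icc_subset_Icc_right ht.2.le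
  · exact (hc.mono Ioo_subset_Icc_self).stronglyMeasurableAtFilter isOpen_Ioo t ht

/-- The data of the variation of an iterated integral of the forms `dz / (z - b_q)`,
`1 ≤ q ≤ M`, along a `C²` family of paths that start at `b_0` and avoid the poles. -/
structure IsVariation (U : Set E) (P Pt : E → ℝ → ℂ) (dP dPt : E → ℝ → E →L[ℝ] ℂ)
    (b : ℕ → E → ℂ) (db : ℕ → E → E →L[ℝ] ℂ) (M : ℕ) : Prop where
  isOpen : IsOpen U
  partials : HasPartials U P Pt dP dPt
  deriv_pole : ∀ q, ∀ x ∈ U, HasFDerivAt (b q) (db q x) x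
  cont_pole : ∀ q, ContinuousOn (db q) U
  source : ∀ x ∈ U, P x 0 = b 0 x
  avoid : ∀ q < M, ∀ x ∈ U, ∀ t ∈ Icc (0 : ℝ) 1, P x t ≠ b (q + 1) x
  ne : ∀ q < M, ∀ x ∈ U, b q x ≠ b (q + 1) x

namespace IsVariation

variable {U : Set E} {P Pt : E → ℝ → ℂ} {dP dPt : E → ℝ → E →L[ℝ] ℂ}
  {b : ℕ → E → ℂ} {db : ℕ → E → E →L[ℝ] ℂ} {M : ℕ}

theorem mapsTo_fst {E : Type*} {U : Set E} :
    MapsTo (Prod.fst : E × ℝ → E) (U ×ˢ Icc (0 : ℝ) 1) U := fun _ hz => hz.1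

theorem cont_b (h : IsVariation U P Pt dP dPt b db M) (q : ℕ) : ContinuousOn (b q) U := fun x hx =>
  (h.deriv_pole q x hx).continuousAt.continuousWithinAt

theorem cont_pulledForm (h : IsVariation U P Pt dP dPt b db M) {q : ℕ} (hq : q < M) :
    ContinuousOn (fun z : E × ℝ => pulledForm P Pt b q z.1 z.2) (U ×ˢ Icc (0 : ℝ) 1) :=
  h.partials.cont_t.div (h.partials.cont.sub
    ((h.cont_b (q + 1)).comp continuousOn_fst mapsTo_fst))
    fun z hz => sub_ne_zero.2 (h.avoid q hq z.1 hz.1 z.2 hz.2)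

theorem cont_skip (h : IsVariation U P Pt dP dPt b db M)
    {m : ℕ} (hm : m < M) (s : ℕ) {q : ℕ} (hq : q < m) :
    ContinuousOn (fun z : E × ℝ => skip s (pulledForm P Pt b) q z.1 z.2)
      (U ×ˢ Icc (0 : ℝ) 1) := by
  unfold skip
  split
  · exact h.cont_pulledForm (by omega)
  · exact h.cont_pulledForm (by omega)

theorem cont_seqInt (h : IsVariation U P Pt dP dPt b db M) {m : ℕ} (hm : m ≤ M) :
    ContinuousOn (fun z : E × ℝ => seqInt (fun q => pulledForm P Pt b q z.1) m z.2)
      (U ×ˢ Icc (0 : ℝ) 1) :=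
  continuousOn_seqInt fun q hq => h.cont_pulledForm (by omega)

theorem cont_seqInt_skip (h : IsVariation U P Pt dP dPt b db M) {m : ℕ} (hm : m < M) (s : ℕ) :
    ContinuousOn (fun z : E × ℝ => seqInt (skip s fun q => pulledForm P Pt b q z.1) m z.2)
      (U ×ˢ Icc (0 : ℝ) 1) := by
  have := continuousOn_seqInt (U := U) (w := skip s (pulledForm P Pt b)) (m := m)
    fun q hq => h.cont_skip hm s hq
  simpa only [skip_apply] using this

theorem cont_dlogSub_pole (h : IsVariation U P Pt dP dPt b db M)
    {i j : ℕ} (hne : ∀ x ∈ U, b i x ≠ b j x) :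
    ContinuousOn (fun z : E × ℝ => dlogSub (b i z.1) (b j z.1) (db i z.1) (db j z.1))
      (U ×ˢ Icc (0 : ℝ) 1) := by
  have : ContinuousOn (fun x => dlogSub (b i x) (b j x) (db i x) (db j x)) U :=
    (((h.cont_b i).sub (h.cont_b j)).inv₀ fun x hx => sub_ne_zero.2 (hne x hx)).smul
      ((h.cont_pole i).sub (h.cont_pole j))
  exact this.comp continuousOn_fst mapsTo_fst

theorem cont_pole' (h : IsVariation U P Pt dP dPt b db M)
    (q : ℕ) : ContinuousOn (fun z : E × ℝ => db q z.1) (U ×ˢ Icc (0 : ℝ) 1) :=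
  (h.cont_pole q).comp continuousOn_fst mapsTo_fst

theorem cont_sub_inv (h : IsVariation U P Pt dP dPt b db M) {q : ℕ} (hq : q < M) :
    ContinuousOn (fun z : E × ℝ => (P z.1 z.2 - b (q + 1) z.1)⁻¹) (U ×ˢ Icc (0 : ℝ) 1) :=
  (h.partials.cont.sub ((h.cont_b (q + 1)).comp continuousOn_fst mapsTo_fst)).inv₀
    fun z hz => sub_ne_zero.2 (h.avoid q hq z.1 hz.1 z.2 hz.2)

theorem cont_seqIntDeriv (h : IsVariation U P Pt dP dPt b db M) {m : ℕ} (hm : m ≤ M) :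
    ContinuousOn (fun z : E × ℝ => seqIntDeriv P Pt dP b db m z.1 z.2)
      (U ×ˢ Icc (0 : ℝ) 1) := by
  cases m with
  | zero => exact continuousOn_const
  | succ m =>
    refine ContinuousOn.add (continuousOn_finsetSum _ fun s hs => ?_) ?_
    · have hs := Finset.mem_range.1 hs
      refine (h.cont_seqInt_skip hm s).smul (ContinuousOn.sub ?_ ?_)
      · exact h.cont_dlogSub_pole fun x hx => (h.ne (s + 1) (by omega) x hx).symm
      · exact h.cont_dlogSub_pole fun x hx => h.ne s (by omega) x hx
    · refine (h.cont_seqInt (by omega)).smul (ContinuousOn.sub ?_ ?_)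
      · exact (h.cont_sub_inv (by omega)).smul (h.partials.cont_x.sub (h.cont_pole' _))
      · exact h.cont_dlogSub_pole fun x hx => h.ne m (by omega) x hx

theorem seqIntDeriv_zero (h : IsVariation U P Pt dP dPt b db M)
    {m : ℕ} {x : E} (hx : x ∈ U) : seqIntDeriv P Pt dP b db m x 0 = 0 := by
  match m with
  | 0 => rfl
  | 1 =>
    have hd : dP x 0 = db 0 x := by
      refine (h.partials.deriv_x x hx 0 (by simp)).unique ?_
      refine (h.deriv_pole 0 x hx).congr_of_eventuallyEq ?_
      filter_upwards [h.isOpen.mem_nhds hx] with y hy using h.source y hy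
    simp [seqIntDeriv, h.source x hx, hd]
  | m + 2 =>
    have h0 : ∀ w : ℕ → ℝ → ℂ, seqInt w (m + 1) 0 = 0 := fun w => by simp [seqInt]
    simp only [seqIntDeriv, h0]
    ext v
    simp

/-- The mixed derivative of `log (P - b_{q+1})`. -/
theorem hasFDerivAt_pulledForm (h : IsVariation U P Pt dP dPt b db M)
    {q : ℕ} (hq : q < M) {x : E} (hx : x ∈ U) {t : ℝ}
    (ht : t ∈ Ioo (0 : ℝ) 1) :
    HasFDerivAt (fun y => pulledForm P Pt b q y t)
      ((P x t - b (q + 1) x)⁻¹ • dPt x t -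
        (Pt x t * ((P x t - b (q + 1) x)⁻¹) ^ 2) • (dP x t - db (q + 1) x)) x := by
  have ht' := Ioo_subset_Icc_self ht
  have hne := sub_ne_zero.2 (h.avoid q hq x hx t ht')
  have h1 := (h.partials.deriv_tx x hx t ht).mul
    ((hasDerivAt_inv hne).comp_hasFDerivAt x
      ((h.partials.deriv_x x hx t ht').sub (h.deriv_pole (q + 1) x hx)))
  refine (h1.congr_fderiv ?_).congr_of_eventuallyEq (Eventually.of_forall fun y => ?_)
  · ext v
    simp
    ring
  · simp [pulledForm, div_eq_mul_inv]

theorem hasDerivAt_dlogSub (h : IsVariation U P Pt dP dPt b db M)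
    {q : ℕ} (hq : q < M) {x : E} (hx : x ∈ U) {t : ℝ}
    (ht : t ∈ Ioo (0 : ℝ) 1) :
    HasDerivAt (fun u => dlogSub (P x u) (b (q + 1) x) (dP x u) (db (q + 1) x))
      ((P x t - b (q + 1) x)⁻¹ • dPt x t -
        (Pt x t * ((P x t - b (q + 1) x)⁻¹) ^ 2) • (dP x t - db (q + 1) x)) t := by
  have ht' := Ioo_subset_Icc_self ht
  have hne := sub_ne_zero.2 (h.avoid q hq x hx t ht')
  have h1 := (((h.partials.deriv_t x hx t ht).sub_const (b (q + 1) x)).inv hne).smul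
    ((h.partials.deriv_xt x hx t ht).sub_const (db (q + 1) x))
  refine h1.congr_deriv ?_
  ext v
  simp
  field_simp
  ring

/-- The three-term relation of the forms `d log (z_i - z_j)` for the moving point and two poles. It
turns the summand in which the moving end point is the neighbour of a pole into the summand in which
the next pole is. -/
theorem pulledForm_mul_dlogSub (h : IsVariation U P Pt dP dPt b db M)
    {k : ℕ} (hk : k + 1 < M) {x : E} (hx : x ∈ U) {t : ℝ}
    (ht : t ∈ Icc (0 : ℝ) 1) :
    pulledForm P Pt b k x t •
        (dlogSub (P x t) (b (k + 2) x) (dP x t) (db (k + 2) x) -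
          dlogSub (b (k + 1) x) (b (k + 2) x) (db (k + 1) x) (db (k + 2) x)) =
      pulledForm P Pt b (k + 1) x t •
        (dlogSub (P x t) (b (k + 1) x) (dP x t) (db (k + 1) x) -
          dlogSub (b (k + 2) x) (b (k + 1) x) (db (k + 2) x) (db (k + 1) x)) := by
  have h1 := sub_ne_zero.2 (h.avoid k (by omega) x hx t ht)
  have h2 := sub_ne_zero.2 (h.avoid (k + 1) (by omega) x hx t ht)
  have h3 := sub_ne_zero.2 (h.ne (k + 1) hk x hx)
  have h4 := sub_ne_zero.2 (h.ne (k + 1) hk x hx).symm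
  ext v
  simp only [pulledForm, dlogSub, _root_.smul_apply, _root_.sub_apply,
    smul_eq_mul]
  have h5 : (b (k + 2) x - b (k + 1) x) = -(b (k + 1) x - b (k + 2) x) := by ring
  rw [h5]
  field_simp
  ring

/-- The time derivative of `seqIntDeriv` for `m + 1` forms is the differential of the integrand
which defines the `(m + 1)`-fold integral. -/
theorem hasDerivAt_seqIntDeriv (h : IsVariation U P Pt dP dPt b db M)
    {m : ℕ} (hm : m + 1 ≤ M) {x : E} (hx : x ∈ U) {t : ℝ}
    (ht : t ∈ Ioo (0 : ℝ) 1) :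
    HasDerivAt (seqIntDeriv P Pt dP b db (m + 1) x)
      (seqInt (fun q => pulledForm P Pt b q x) m t •
          ((P x t - b (m + 1) x)⁻¹ • dPt x t -
            (Pt x t * ((P x t - b (m + 1) x)⁻¹) ^ 2) • (dP x t - db (m + 1) x)) +
        pulledForm P Pt b m x t • seqIntDeriv P Pt dP b db m x t) t := by
  have ht' := Ioo_subset_Icc_self ht
  have hψ := (h.hasDerivAt_dlogSub (q := m) (by omega) hx ht).sub_const
    (dlogSub (b m x) (b (m + 1) x) (db m x) (db (m + 1) x))
  match m with
  | 0 =>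
    have := hψ.const_smul (1 : ℂ)
    have h0 : seqIntDeriv P Pt dP b db (0 + 1) x = fun u => (1 : ℂ) •
        (dlogSub (P x u) (b (0 + 1) x) (dP x u) (db (0 + 1) x) -
          dlogSub (b 0 x) (b (0 + 1) x) (db 0 x) (db (0 + 1) x)) := by
      funext u; simp [seqIntDeriv, seqInt]
    rw [h0]
    refine this.congr_deriv ?_
    ext v
    simp [seqIntDeriv, seqInt]
  | k + 1 =>
    have hw : ∀ q ≤ k, ContinuousOn (pulledForm P Pt b q x) (Icc 0 1) := fun q hq =>
      continuousOn_slice (h.cont_pulledForm (by omega)) hx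
    have hN := hasDerivAt_seqInt hw ht
    have hS : ∀ s ∈ Finset.range (k + 1), HasDerivAt (fun u =>
        seqInt (skip s fun q => pulledForm P Pt b q x) (k + 1) u • dlogRatio b db s x)
        ((seqInt (skip s fun q => pulledForm P Pt b q x) k t * pulledForm P Pt b (k + 1) x t) •
          dlogRatio b db s x) t := by
      intro s hs
      have hs := Finset.mem_range.1 hs
      have := hasDerivAt_seqInt (w := skip s fun q => pulledForm P Pt b q x) (m := k)
        (fun q hq => by
          rw [← skip_apply]
          exact continuousOn_slice (h.cont_skip (m := k + 1) (by omega) s (by omega)) hx) ht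
      have hs' : skip s (fun q => pulledForm P Pt b q x) k = pulledForm P Pt b (k + 1) x := by
        simp [skip, show ¬ k < s by omega]
      rw [hs'] at this
      exact this.smul_const (dlogRatio b db s x)
    have hD := (HasDerivAt.fun_sum hS).add (hN.smul hψ)
    refine hD.congr_deriv ?_
    have key := h.pulledForm_mul_dlogSub (k := k) (by omega) hx ht'
    have hlast : seqInt (skip k fun q => pulledForm P Pt b q x) k t =
        seqInt (fun q => pulledForm P Pt b q x) k t := seqInt_skip_self ht'
    rw [Finset.sum_range_succ, hlast]
    simp only [seqIntDeriv, smul_add, Finset.smul_sum, mul_comm _ (pulledForm P Pt b (k + 1) x t),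
      mul_smul]
    rw [key]
    simp only [dlogRatio]
    module

/-- The integrand is differentiated under the integral sign, and the integral of its differential
is evaluated by the fundamental theorem of calculus. -/
theorem hasFDerivAt_seqInt (h : IsVariation U P Pt dP dPt b db M)
    {m : ℕ} (hm : m ≤ M) {x : E} (hx : x ∈ U) {t : ℝ}
    (ht : t ∈ Icc (0 : ℝ) 1) :
    HasFDerivAt (fun y => seqInt (fun q => pulledForm P Pt b q y) m t)
      (seqIntDeriv P Pt dP b db m x t) x := by
  induction m generalizing x t with
  | zero => exact hasFDerivAt_const _ _
  | succ m ih =>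
    have hc := (h.cont_seqInt (m := m) (by omega)).mul (h.cont_pulledForm (q := m) (by omega))
    have hc' : ContinuousOn (fun z : E × ℝ =>
        seqInt (fun q => pulledForm P Pt b q z.1) m z.2 •
          ((P z.1 z.2 - b (m + 1) z.1)⁻¹ • dPt z.1 z.2 -
            (Pt z.1 z.2 * ((P z.1 z.2 - b (m + 1) z.1)⁻¹) ^ 2) • (dP z.1 z.2 - db (m + 1) z.1)) +
        pulledForm P Pt b m z.1 z.2 • seqIntDeriv P Pt dP b db m z.1 z.2)
        (U ×ˢ Icc (0 : ℝ) 1) := by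
      have hi := h.cont_sub_inv (q := m) (by omega)
      exact ((h.cont_seqInt (by omega)).smul ((hi.smul h.partials.cont_tx).sub
        ((h.partials.cont_t.mul (hi.pow 2)).smul (h.partials.cont_x.sub (h.cont_pole' _))))).add
        ((h.cont_pulledForm (by omega)).smul (h.cont_seqIntDeriv (by omega)))
    have key := hasFDerivAt_integral_param h.isOpen
      (G := fun y u => seqInt (fun q => pulledForm P Pt b q y) m u * pulledForm P Pt b m y u)
      (G' := fun x t => seqInt (fun q => pulledForm P Pt b q x) m t •
          ((P x t - b (m + 1) x)⁻¹ • dPt x t -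
            (Pt x t * ((P x t - b (m + 1) x)⁻¹) ^ 2) • (dP x t - db (m + 1) x)) +
        pulledForm P Pt b m x t • seqIntDeriv P Pt dP b db m x t) hc hc'
      (fun y hy u hu => (ih (by omega) hy (Ioo_subset_Icc_self hu)).mul
        (h.hasFDerivAt_pulledForm (by omega) hy hu)) hx ht
    refine key.congr_fderiv ?_
    have hsub : Icc 0 t ⊆ Icc (0 : ℝ) 1 := Icc_subset_Icc_right ht.2
    have hcx := continuousOn_slice (G := fun x t => seqInt (fun q => pulledForm P Pt b q x) m t •
          ((P x t - b (m + 1) x)⁻¹ • dPt x t -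
            (Pt x t * ((P x t - b (m + 1) x)⁻¹) ^ 2) • (dP x t - db (m + 1) x)) +
        pulledForm P Pt b m x t • seqIntDeriv P Pt dP b db m x t) hc' hx
    have hFTC := intervalIntegral.integral_eq_sub_of_hasDerivAt_of_le ht.1
      ((continuousOn_slice (h.cont_seqIntDeriv hm) hx).mono hsub)
      (fun u hu => h.hasDerivAt_seqIntDeriv hm hx ⟨hu.1, hu.2.trans_le ht.2⟩)
      ((hcx.mono (by rw [uIcc_of_le ht.1]; exact hsub)).intervalIntegrable)
    rw [hFTC, h.seqIntDeriv_zero hx, sub_zero]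

/-- When the paths end at `b_{m+1}`, the end point needs no separate treatment: the differential of
the iterated integral is the sum, over the forms that may be left out, of the remaining integral
times `d log ((b_{s+2} - b_{s+1}) / (b_s - b_{s+1}))`. -/
theorem hasFDerivAt_seqInt_one (h : IsVariation U P Pt dP dPt b db M)
    {m : ℕ} (hm : m ≤ M) (target : ∀ x ∈ U, P x 1 = b (m + 1) x)
    {x : E} (hx : x ∈ U) :
    HasFDerivAt (fun y => seqInt (fun q => pulledForm P Pt b q y) m 1)
      (∑ s ∈ Finset.range m,
        seqInt (skip s fun q => pulledForm P Pt b q x) (m - 1) 1 • dlogRatio b db s x) x := by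
  have h1 : (1 : ℝ) ∈ Icc (0 : ℝ) 1 := by simp
  refine (h.hasFDerivAt_seqInt hm hx h1).congr_fderiv ?_
  cases m with
  | zero => rfl
  | succ m =>
    have hd : dP x 1 = db (m + 2) x := by
      refine (h.partials.deriv_x x hx 1 h1).unique ?_
      refine (h.deriv_pole (m + 2) x hx).congr_of_eventuallyEq ?_
      filter_upwards [h.isOpen.mem_nhds hx] with y hy using target y hy
    rw [Finset.sum_range_succ, Nat.add_sub_cancel, seqInt_skip_self h1]
    simp only [seqIntDeriv, target x hx, hd]
    rfl

end IsVariation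

end IteratedIntegral

/-! ### The points `a_s` off the divisor -/

section Divisor

variable {n : ℕ}

theorem mem_S {x : Pt n} :
    x ∈ S n ↔ (∀ j, x j ≠ 0) ∧ ∀ j k, j ≤ k → 1 - ∏ α ∈ Icc j k, x α ≠ 0 := by
  simp only [S, Set.mem_ofPred_eq, mul_ne_zero_iff, prod_ne_zero_iff, mem_univ, true_imp_iff,
    mem_filter, true_and]
  constructor
  · rintro ⟨h1, h2⟩
    refine ⟨fun j => (h1 j).1, fun j k hjk => ?_⟩
    rcases hjk.lt_or_eq with h | rfl
    · exact h2 j k h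
    · simpa using (h1 j).2
  · rintro ⟨h1, h2⟩
    exact ⟨fun j => ⟨h1 j, by simpa using h2 j j le_rfl⟩, fun j k hjk => h2 j k hjk.le⟩

theorem isOpen_S (n : ℕ) : IsOpen (S n) := by
  refine isOpen_ne_fun ?_ continuous_const
  fun_prop

theorem a_zero (x : Pt n) : a x 0 = 0 := by simp [a]

theorem a_ne_zero {x : Pt n} (hx : ∀ j, x j ≠ 0) {s : ℕ} (hs : s ≠ 0) : a x s ≠ 0 := by
  rw [a, if_neg hs]
  exact inv_ne_zero (prod_ne_zero_iff.2 fun α _ => hx α)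

/-- The one-based places in `[s, t)` as an interval of `Fin n`. -/
theorem filter_place_eq_Icc {s t : ℕ} (hs : 1 ≤ s) (hst : s < t) (ht : t ≤ n + 1) :
    univ.filter (fun α : Fin n => s ≤ (α : ℕ) + 1 ∧ (α : ℕ) + 1 < t) =
      Icc ⟨s - 1, by omega⟩ ⟨t - 2, by omega⟩ := by
  ext α
  simp only [mem_filter, mem_univ, true_and, mem_Icc, Fin.le_def]
  omega

theorem a_eq_mul {x : Pt n} (hx : ∀ j, x j ≠ 0) {s t : ℕ} (hs : 1 ≤ s) (hst : s < t)
    (ht : t ≤ n + 1) :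
    a x t = a x s * ∏ α ∈ Icc (⟨s - 1, by omega⟩ : Fin n) ⟨t - 2, by omega⟩, x α := by
  have hd : univ.filter (fun α : Fin n => s ≤ (α : ℕ) + 1) =
      Icc ⟨s - 1, by omega⟩ ⟨t - 2, by omega⟩ ∪
        univ.filter (fun α : Fin n => t ≤ (α : ℕ) + 1) := by
    rw [← filter_place_eq_Icc hs hst ht]
    ext α
    simp only [mem_filter, mem_univ, true_and, mem_union]
    omega
  rw [a, a, if_neg (by omega), if_neg (by omega), hd, prod_union]
  · have h1 := prod_ne_zero_iff.2 fun (α : Fin n)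
      (_ : α ∈ Icc (⟨s - 1, by omega⟩ : Fin n) ⟨t - 2, by omega⟩) => hx α
    have h2 := prod_ne_zero_iff.2 fun (α : Fin n)
      (_ : α ∈ univ.filter (fun α : Fin n => t ≤ (α : ℕ) + 1)) => hx α
    field_simp
  · rw [← filter_place_eq_Icc hs hst ht, disjoint_filter]
    intro α _ h
    omega

theorem a_ne {x : Pt n} (hx : x ∈ S n) {s t : ℕ} (hst : s < t) (ht : t ≤ n + 1) :
    a x s ≠ a x t := by
  rw [mem_S] at hx
  rcases Nat.eq_zero_or_pos s with rfl | hs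
  · rw [a_zero]
    exact (a_ne_zero hx.1 (by omega)).symm
  · rw [a_eq_mul hx.1 hs hst ht]
    intro h
    refine hx.2 ⟨s - 1, by omega⟩ ⟨t - 2, by omega⟩ (by simp [Fin.le_def]; omega) ?_
    have h0 := a_ne_zero hx.1 (s := s) (by omega)
    have h1 : a x s * (1 - ∏ α ∈ Icc (⟨s - 1, by omega⟩ : Fin n) ⟨t - 2, by omega⟩, x α) = 0 := by
      rw [mul_sub, mul_one, ← h, sub_self]
    exact (mul_eq_zero.1 h1).resolve_left h0

theorem contDiffAt_a {x : Pt n} (hx : ∀ j, x j ≠ 0) (s : ℕ) {m : WithTop ℕ∞} :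
    ContDiffAt ℂ m (fun x' : Pt n => a x' s) x := by
  unfold a
  split_ifs
  · exact contDiffAt_const
  · refine ContDiffAt.inv ?_ (prod_ne_zero_iff.2 fun α _ => hx α)
    fun_prop

theorem a_place_ne {x : Pt n} (hx : x ∈ S n) (i : Idx n) {s t : ℕ} (hst : s < t)
    (ht : t ≤ i.card + 1) : a x (place i s) ≠ a x (place i t) :=
  a_ne hx (place_lt i hst ht) (place_le_last i ht)

end Divisor

/-! ### The connection form in terms of the points `a_s` -/

section Connection

variable {n : ℕ}

/-- The ratio `(a_{s+1} - a_s) / (a_{s-1} - a_s)` of the point `x(i)`, for `s = m + 1`,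
written with the points `a` of `x`. -/
def ratio (i : Idx n) (m : ℕ) (x : Pt n) : ℂ :=
  (a x (place i (m + 2)) - a x (place i (m + 1))) / (a x (place i m) - a x (place i (m + 1)))

theorem omega_dropAt (i : Idx n) {m : ℕ} (hm : m < i.card) (x : Pt n) :
    omega x i (dropAt i (m + 1)) = -dlog (ratio i m) x := by
  have hc : (retract i (dropAt i (m + 1)))ᶜ = {⟨m, hm⟩} := by
    ext q
    have h1 := place_succ i q.2
    have h2 : place i (q + 1) = place i (m + 1) ↔ (q : ℕ) + 1 = m + 1 :=
      place_inj i (by omega) (by omega)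
    rw [h1] at h2
    simp only [retract, dropAt, mem_compl, mem_filter, mem_univ, true_and, mem_singleton,
      Fin.ext_iff, orderEmbOfFin_mem, ne_eq, not_not]
    rw [h2]
    omega
  rw [omega, of_apply, if_pos ⟨dropAt_subset _ _, card_dropAt (by omega) (by omega)⟩, hc,
    sum_singleton]
  congr 2
  funext x'
  simp only [ratio]
  rw [a_sub i x' (by omega), a_sub i x' (by omega), a_sub i x' (by omega)]

theorem omega_eq_zero {i k : Idx n} (h : ¬(k ⊆ i ∧ k.card + 1 = i.card)) (x : Pt n) :
    omega x i k = 0 := by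
  rw [omega, of_apply, if_neg h]

theorem ratio_ne_zero {x : Pt n} (hx : x ∈ S n) (i : Idx n) {m : ℕ} (hm : m < i.card) :
    ratio i m x ≠ 0 :=
  div_ne_zero (sub_ne_zero.2 (a_place_ne hx i (by omega) (by omega)).symm)
    (sub_ne_zero.2 (a_place_ne hx i (by omega) (by omega)))

theorem contDiffAt_ratio {x : Pt n} (hx : x ∈ S n) (i : Idx n) {m : ℕ} (hm : m < i.card)
    {k : WithTop ℕ∞} : ContDiffAt ℂ k (ratio i m) x := by
  have h0 := (mem_S.1 hx).1
  exact ((contDiffAt_a h0 _).sub (contDiffAt_a h0 _)).div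
    ((contDiffAt_a h0 _).sub (contDiffAt_a h0 _))
    (sub_ne_zero.2 (a_place_ne hx i (by omega) (by omega)))

theorem hasFDerivAt_a {x : Pt n} (hx : x ∈ S n) (s : ℕ) :
    HasFDerivAt (fun x' : Pt n => a x' s) (fderiv ℂ (fun x' : Pt n => a x' s) x) x :=
  ((contDiffAt_a (mem_S.1 hx).1 s (m := 1)).differentiableAt (by simp)).hasFDerivAt

theorem dlog_div_apply {f g : Pt n → ℂ} {f' g' : Form n} {x : Pt n} (hf : HasFDerivAt f f' x)
    (hg : HasFDerivAt g g' x) (hf0 : f x ≠ 0) (hg0 : g x ≠ 0) :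
    dlog (fun x' => f x' / g x') x = (f x)⁻¹ • f' - (g x)⁻¹ • g' := by
  have h : HasFDerivAt (fun x' => f x' / g x') _ x :=
    hf.mul ((hasDerivAt_inv hg0).comp_hasFDerivAt x hg)
  rw [dlog, h.fderiv]
  ext v
  simp
  field_simp
  ring

theorem dlogRatio_eq_omega {x : Pt n} (hx : x ∈ S n) (i : Idx n) (T : ℕ) {s : ℕ}
    (hs : T + s < i.card) :
    dlogRatio (fun q y => a y (place i (T + q)))
      (fun q y => (fderiv ℂ (fun x' : Pt n => a x' (place i (T + q))) y).restrictScalars ℝ) s x =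
      (-omega x i (dropAt i (T + s + 1))).restrictScalars ℝ := by
  rw [omega_dropAt i hs, neg_neg]
  have h := dlog_div_apply
    ((hasFDerivAt_a hx (place i (T + s + 2))).sub (hasFDerivAt_a hx (place i (T + s + 1))))
    ((hasFDerivAt_a hx (place i (T + s))).sub (hasFDerivAt_a hx (place i (T + s + 1))))
    (sub_ne_zero.2 (a_place_ne hx i (by omega) (by omega)).symm)
    (sub_ne_zero.2 (a_place_ne hx i (by omega) (by omega)))
  have h' : dlog (ratio i (T + s)) x = _ := h
  rw [h']
  ext v
  rfl

end Connection

/-! ### The differentials of the entries -/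

section Entry

variable {n : ℕ}

/-- The factor of `γ^{|i|}_{ρ_i(j)}(x(i))` that belongs to the path `P` from `a_{t_r}(x)` to
`a_{t_{r+1}}(x)`. -/
def factor (i j : Idx n) (r : ℕ) (P : ℝ → ℂ) (x : Pt n) : ℂ :=
  seqInt (fun q => pullTheta (a x (place i (place (retract i j) r + 1 + q))) P)
    (place (retract i j) (r + 1) - place (retract i j) r - 1) 1

theorem entry_eq_prod {i j : Idx n} (h : j ⊆ i) (p : Idx n → ℕ → ℝ → ℂ) (x : Pt n) :
    entry p x i j =
      (-1) ^ (i.card - j.card) * ∏ r ∈ range (j.card + 1), factor i j r (p j r) x := by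
  rw [entry, if_pos h, gamma, card_retract h]
  congr 1
  refine prod_congr rfl fun r hr => ?_
  have hr := mem_range.1 hr
  have hc := card_retract h
  have hle := place_le_last (retract i j) (r := r + 1) (by omega)
  rw [factor, ← iterInt_eq_seqInt]
  congr 1
  funext q
  rw [a_sub]
  have := q.2
  omega

theorem factor_dropAt_of_notMem {i j : Idx n} {s : ℕ} (h1 : 1 ≤ s) (h2 : s ≤ i.card)
    (h : j ⊆ dropAt i s) {r : ℕ} (hr : r ≤ j.card)
    (hs : ¬(place (retract i j) r < s ∧ s < place (retract i j) (r + 1))) (P : ℝ → ℂ) (x : Pt n) :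
    factor (dropAt i s) j r P x = factor i j r P x := by
  have hji := h.trans (dropAt_subset i s)
  have hcj := card_retract hji
  have hlt := place_lt_succ (retract i j) (r := r) (by omega)
  have hle := place_le_last (retract i j) (r := r + 1) (by omega)
  have hn1 := place_retract_ne h1 h2 h (r := r) (by omega)
  have hn2 := place_retract_ne h1 h2 h (r := r + 1) (by omega)
  rw [factor, factor, place_retract_dropAt h1 h2 h (by omega),
    place_retract_dropAt h1 h2 h (by omega)]
  have e : (if place (retract i j) (r + 1) < s then place (retract i j) (r + 1)
        else place (retract i j) (r + 1) - 1) -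
      (if place (retract i j) r < s then place (retract i j) r
        else place (retract i j) r - 1) - 1 =
      place (retract i j) (r + 1) - place (retract i j) r - 1 := by
    split_ifs <;> omega
  rw [e]
  refine seqInt_congr (by simp) fun q hq u _ => ?_
  rw [place_dropAt h1 h2 (by split_ifs <;> omega)]
  congr 3
  split_ifs <;> omega

/-- Leaving out the one number `s` of `i`, which lies in the gap `r` of `j`, removes one form from the
iterated integral over that gap. -/
theorem factor_dropAt_of_mem {i j : Idx n} {s : ℕ} (h1 : 1 ≤ s) (h2 : s ≤ i.card)
    (h : j ⊆ dropAt i s) {r : ℕ} (hr : r ≤ j.card) (hs1 : place (retract i j) r < s)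
    (hs2 : s < place (retract i j) (r + 1)) (P : ℝ → ℂ) (x : Pt n) :
    factor (dropAt i s) j r P x =
      seqInt (skip (s - place (retract i j) r - 1)
          fun q => pullTheta (a x (place i (place (retract i j) r + 1 + q))) P)
        (place (retract i j) (r + 1) - place (retract i j) r - 1 - 1) 1 := by
  have hji := h.trans (dropAt_subset i s)
  have hcj := card_retract hji
  have hle := place_le_last (retract i j) (r := r + 1) (by omega)
  rw [factor, place_retract_dropAt h1 h2 h (by omega), place_retract_dropAt h1 h2 h (by omega),
    if_pos hs1, if_neg (by omega)]
  have e : place (retract i j) (r + 1) - 1 - place (retract i j) r - 1 =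
      place (retract i j) (r + 1) - place (retract i j) r - 1 - 1 := by omega
  rw [e]
  refine seqInt_congr (by simp) fun q hq u _ => ?_
  rw [place_dropAt h1 h2 (by omega)]
  simp only [skip]
  by_cases hqs : q < s - place (retract i j) r - 1
  · rw [if_pos hqs, if_pos (by omega)]
  · rw [if_neg hqs, if_neg (by omega)]
    rfl

variable {U : Set (Pt n)} {p : Idx n → ℕ → Pt n → ℝ → ℂ}

theorem hasFDerivAt_factor (hU : IsOpen U) (hUS : U ⊆ S n) (hp : IsPathFamily U p) {i j : Idx n}
    (h : j ⊆ i) {r : ℕ} (hr : r ≤ j.card) {x : Pt n} (hx : x ∈ U) :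
    HasFDerivAt (fun y => factor i j r (p j r y) y)
      (∑ s ∈ range (place (retract i j) (r + 1) - place (retract i j) r - 1),
        factor (dropAt i (place (retract i j) r + s + 1)) j r (p j r x) x •
          -omega x i (dropAt i (place (retract i j) r + s + 1))) x := by
  have hcj := card_retract h
  have hle := place_le_last (retract i j) (r := r + 1) (by omega)
  have hlt := place_lt_succ (retract i j) (r := r) (by omega)
  have hT := place_retract h (r := r) (by omega)
  have hT' := place_retract h (r := r + 1) (by omega)
  have hsub : ∀ s, place (retract i j) r < s → s < place (retract i j) (r + 1) →
      j ⊆ dropAt i s := by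
    intro s hs1 hs2
    refine subset_dropAt h (by omega) fun r' hr1 hr2 hs => ?_
    rw [← hs, place_lt_iff _ (by omega) (by omega)] at hs1 hs2
    omega
  set T := place (retract i j) r with hTdef
  set M := place (retract i j) (r + 1) - T - 1 with hM
  obtain ⟨Pt, dP, dPt, hpart⟩ := exists_hasPartials hU (hp.smooth j r hr)
  have hpath : ∀ y ∈ U, IsPathSystem y fun j r => p j r y := hp.system
  have hvar : IsVariation U (p j r) Pt dP dPt (fun q y => a y (place i (T + q)))
      (fun q y => (fderiv ℂ (fun x' : MultiLog.Pt n => a x' (place i (T + q))) y).restrictScalars ℝ)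
      M := by
    refine ⟨hU, hpart, ?_, ?_, ?_, ?_, ?_⟩
    · intro q y hy
      exact (hasFDerivAt_a (hUS hy) _).restrictScalars ℝ
    · intro q y hy
      have h1 : ContinuousAt (fderiv ℂ (fun x' : MultiLog.Pt n => a x' (place i (T + q)))) y :=
        ((contDiffAt_a (m := 1) (mem_S.1 (hUS hy)).1 _).fderiv_right (m := 0)
          (by simp)).continuousAt
      exact ((ContinuousLinearMap.restrictScalarsL ℂ (MultiLog.Pt n) ℂ ℝ
        ℝ).continuous.continuousAt.comp h1).continuousWithinAt
    · intro y hy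
      exact ((hpath y hy).source j r hr).trans (by rw [← hT, add_zero])
    · intro q hq y hy t ht
      refine (hpath y hy).avoid j r hr t ht _ ?_ ?_
      · rw [← hT]; exact place_lt i (by omega) (by omega)
      · rw [← hT']; exact place_lt i (by omega) (by omega)
    · intro q hq y hy
      exact a_place_ne (hUS hy) i (by omega) (by omega)
  have key := hvar.hasFDerivAt_seqInt_one le_rfl (fun y hy => by
    rw [(hpath y hy).target j r hr, ← hT']
    congr 2
    omega) hx
  have hform : ∀ y ∈ U, ∀ q, ∀ u ∈ Set.Icc (0 : ℝ) 1,
      pullTheta (a y (place i (T + 1 + q))) (p j r y) u =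
        pulledForm (p j r) Pt (fun q y => a y (place i (T + q))) q y u := by
    intro y hy q u hu
    rw [pullTheta, pulledForm, hpart.derivWithin_t y hy u hu]
    simp only [add_assoc, add_comm 1 q]
  refine hasFDerivAt_of_restrictScalars ℝ (f' := _) (g' := _) ?_ rfl
  refine (key.congr_of_eventuallyEq ?_).congr_fderiv ?_
  · filter_upwards [hU.mem_nhds hx] with y hy
    exact seqInt_congr (by simp) fun q _ u hu => hform y hy q u hu
  · have hterm : ∀ s ∈ range M,
        seqInt (skip s fun q => pulledForm (p j r) Pt (fun q y => a y (place i (T + q))) q x)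
          (M - 1) 1 =
        factor (dropAt i (T + s + 1)) j r (p j r x) x := by
      intro s hs
      have hs := mem_range.1 hs
      rw [factor_dropAt_of_mem (by omega) (by omega) (hsub _ (by omega) (by omega)) hr
        (by omega) (by omega)]
      have e : T + s + 1 - T - 1 = s := by omega
      rw [← hTdef, e]
      refine seqInt_congr (by simp) fun q _ u hu => ?_
      simp only [skip]
      split_ifs <;> exact (hform x hx _ u hu).symm
    rw [sum_congr rfl fun s hs => by
      rw [hterm s hs, dlogRatio_eq_omega (hUS hx) i T (by have := mem_range.1 hs; omega)]]
    ext v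
    simp

end Entry

section EntryDeriv

variable {n : ℕ}

/-! The scalar action on `Form n` is found through `ContinuousLinearMap.instSMul`, which unification
does not identify with the action of the module structure; the axioms are restated for it. -/

theorem form_zero_smul (η : Form n) : (0 : ℂ) • η = 0 := by ext v; simp

theorem form_smul_zero (c : ℂ) : c • (0 : Form n) = 0 := by ext v; simp

theorem form_add_zsmul (c d : ℤ) (η : Form n) : (c + d) • η = c • η + d • η := by
  ext v; simp [add_mul]

theorem form_neg_smul (c : ℂ) (η : Form n) : -c • η = -(c • η) := by ext v; simp

theorem form_sub_smul (c d : ℂ) (η : Form n) : (c - d) • η = c • η - d • η := by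
  ext v; simp [sub_mul]

theorem form_sum_smul {ι : Type*} (s : Finset ι) (c : ι → ℂ) (η : Form n) :
    (∑ i ∈ s, c i) • η = ∑ i ∈ s, c i • η := by
  ext v; simp [sum_mul]

variable {U : Set (Pt n)} {p : Idx n → ℕ → Pt n → ℝ → ℂ}

theorem entry_of_not_subset {i j : Idx n} (h : ¬j ⊆ i) (p : Idx n → ℕ → ℝ → ℂ) (x : Pt n) :
    entry p x i j = 0 := if_neg h

/-- Leaving out a place in the gap `(t_r, t_{r+1})` of `j` changes only the `r`-th factor. -/
theorem entry_dropAt {i j : Idx n} {s : ℕ} (h1 : 1 ≤ s) (h2 : s ≤ i.card) (h : j ⊆ dropAt i s)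
    {r : ℕ} (hr : r ≤ j.card) (hs1 : place (retract i j) r < s)
    (hs2 : s < place (retract i j) (r + 1)) (p : Idx n → ℕ → ℝ → ℂ) (x : Pt n) :
    entry p x (dropAt i s) j = -((-1) ^ (i.card - j.card) *
      ((∏ r' ∈ (range (j.card + 1)).erase r, factor i j r' (p j r') x) *
        factor (dropAt i s) j r (p j r) x)) := by
  have hji := h.trans (dropAt_subset i s)
  have hc := card_dropAt h1 h2
  have hcj := card_retract hji
  have hle := card_le_card h
  rw [entry_eq_prod h, show i.card - j.card = (dropAt i s).card - j.card + 1 by omega, pow_succ,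
    ← prod_erase_mul _ _ (mem_range.2 (show r < j.card + 1 by omega))]
  have : ∏ r' ∈ (range (j.card + 1)).erase r, factor (dropAt i s) j r' (p j r') x =
      ∏ r' ∈ (range (j.card + 1)).erase r, factor i j r' (p j r') x := by
    refine prod_congr rfl fun r' hr' => ?_
    rw [mem_erase, mem_range] at hr'
    refine factor_dropAt_of_notMem h1 h2 h (by omega) ?_ _ _
    rintro ⟨h3, h4⟩
    rcases lt_or_gt_of_ne hr'.1 with hlt | hlt
    · have := place_le (retract i j) (r := r' + 1) (s := r) (by omega) (by omega)
      omega
    · have := place_le (retract i j) (r := r + 1) (s := r') (by omega) (by omega)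
      omega
  rw [this]
  ring

/-- The product rule gives one summand for each number `s` of a one of `i` outside `j`, the entry at
`dropAt i s` times the form that belongs to `s`. -/
theorem hasFDerivAt_entry (hU : IsOpen U) (hUS : U ⊆ S n) (hp : IsPathFamily U p)
    (i j : Idx n) {x : Pt n} (hx : x ∈ U) :
    HasFDerivAt (fun y => entry (fun j r => p j r y) y i j)
      (∑ k, entry (fun j r => p j r x) x k j • omega x i k) x := by
  by_cases h : j ⊆ i
  swap
  · -- if `j` is not below `i`, then it is below no `k ⊆ i`
    have e : ∀ k, entry (fun j r => p j r x) x k j • omega x i k = 0 := by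
      intro k
      by_cases hk : k ⊆ i ∧ k.card + 1 = i.card
      · rw [entry_of_not_subset fun hjk => h (hjk.trans hk.1), form_zero_smul]
      · rw [omega_eq_zero hk, form_smul_zero]
    simp only [e, sum_const_zero, entry_of_not_subset h]
    exact hasFDerivAt_const _ _
  have hcj := card_retract h
  have hfac := (HasFDerivAt.finsetProd (u := range (j.card + 1))
    (g := fun r y => factor i j r (p j r y) y) (x := x)
    fun r hr => hasFDerivAt_factor hU hUS hp h (by have := mem_range.1 hr; omega) hx).const_mul
      ((-1 : ℂ) ^ (i.card - j.card))
  refine (hfac.congr_of_eventuallyEq (Filter.Eventually.of_forall fun y => ?_)).congr_fderiv ?_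
  · exact entry_eq_prod h _ y
  have hlast : ∀ r ≤ j.card, place (retract i j) (r + 1) ≤ i.card + 1 := fun r hr =>
    place_le_last _ (by omega)
  have hsub : ∀ r ≤ j.card, ∀ s, place (retract i j) r < s → s < place (retract i j) (r + 1) →
      j ⊆ dropAt i s := by
    intro r hr s hs1 hs2
    have := hlast r hr
    refine subset_dropAt h (by omega) fun r' hr1 hr2 hs => ?_
    rw [← hs, place_lt_iff _ (by omega) (by omega)] at hs1 hs2
    omega
  simp only [smul_sum]
  rw [sum_sigma']
  -- the pairs of a gap of `j` and a place in it enumerate the `k` between `j` and `i` of weight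
  -- `|i| - 1`
  refine sum_of_injOn (fun z : (_ : ℕ) × ℕ => dropAt i (place (retract i j) z.1 + z.2 + 1))
    ?_ (fun _ _ => by simp) ?_ ?_
  · rintro ⟨r, s⟩ hz ⟨r', s'⟩ hz' heq
    simp only [mem_coe, mem_sigma, mem_range] at hz hz'
    change dropAt i (place (retract i j) r + s + 1) = dropAt i (place (retract i j) r' + s' + 1)
      at heq
    have l1 := hlast r (by omega)
    have l2 := hlast r' (by omega)
    have e := dropAt_injOn (by omega) (by omega) (by omega) heq
    have : r = r' := by
      rcases lt_trichotomy r r' with hlt | hlt | hlt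
      · have := place_le (retract i j) (r := r + 1) (s := r') (by omega) (by omega)
        omega
      · exact hlt
      · have := place_le (retract i j) (r := r' + 1) (s := r) (by omega) (by omega)
        omega
    subst this
    rw [show s = s' by omega]
  · intro k _ hk
    by_cases hki : k ⊆ i ∧ k.card + 1 = i.card
    swap
    · rw [omega_eq_zero hki, form_smul_zero]
    by_cases hjk : j ⊆ k
    swap
    · rw [entry_of_not_subset hjk, form_zero_smul]
    obtain ⟨s, h1, h2, rfl⟩ := exists_eq_dropAt hki.1 hki.2
    obtain ⟨r, hr, hr1, hr2⟩ := exists_place_lt (retract i j) h1 h2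
      fun r hr => place_retract_ne h1 h2 hjk (by omega)
    refine absurd ⟨⟨r, s - place (retract i j) r - 1⟩, ?_, ?_⟩ hk
    · simp only [mem_coe, mem_sigma, mem_range]
      omega
    · simp only
      congr 1
      omega
  · rintro ⟨r, s⟩ hz
    simp only [mem_sigma, mem_range] at hz
    have l1 := hlast r (by omega)
    simp only
    rw [entry_dropAt (r := r) (by omega) (by omega) (hsub r (by omega) _ (by omega) (by omega))
      (by omega) (by omega) (by omega)]
    simp only [smul_neg, form_neg_smul, smul_smul]

theorem entry_self (p : Idx n → ℕ → ℝ → ℂ) (x : Pt n) (i : Idx n) : entry p x i i = 1 := by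
  have hc := card_retract (subset_refl i)
  have hT : ∀ r ≤ i.card + 1, place (retract i i) r = r := fun r hr =>
    (place_inj i (place_le_last _ (by omega)) hr).1 (place_retract (subset_refl i) hr)
  rw [entry_eq_prod (subset_refl i), Nat.sub_self, pow_zero, one_mul]
  refine prod_eq_one fun r hr => ?_
  have hr := mem_range.1 hr
  rw [factor, hT r (by omega), hT (r + 1) (by omega), show r + 1 - r - 1 = 0 by omega]
  rfl

theorem sum_smul_omega (X : Idx n → ℂ) (x : Pt n) (i : Idx n) :
    ∑ k, X k • omega x i k =
      ∑ k ∈ univ.filter (fun k : Idx n => k ⊆ i ∧ k.card + 1 = i.card), X k • omega x i k := by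
  rw [sum_filter]
  refine sum_congr rfl fun k _ => ?_
  split_ifs with h
  · rfl
  · rw [omega_eq_zero h, form_smul_zero]

/-- For `|k| = |i| - 1` the only entry `(k', k)` with `k' ⊂ i` of weight `|i| - 1` which does not
vanish is the diagonal one. -/
theorem hasFDerivAt_gamma (hU : IsOpen U) (hUS : U ⊆ S n) (hp : IsPathFamily U p)
    {i k : Idx n} (hki : k ⊆ i) (hc : k.card + 1 = i.card) {x : Pt n} (hx : x ∈ U) :
    HasFDerivAt (fun x' => gamma (retract i k) (sub i x') (fun r => p k r x')) (omega x i k) x := by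
  have h := hasFDerivAt_entry hU hUS hp i k hx
  have e : (∑ k', entry (fun j r => p j r x) x k' k • omega x i k') = omega x i k := by
    rw [sum_eq_single k, entry_self, one_smul]
    · intro k' _ hne
      by_cases h1 : k' ⊆ i ∧ k'.card + 1 = i.card
      · rw [entry_of_not_subset, form_zero_smul]
        exact fun h2 => hne (eq_of_subset_of_card_le h2 (by omega)).symm
      · rw [omega_eq_zero h1, form_smul_zero]
    · simp
  rw [e] at h
  refine h.congr_of_eventuallyEq (Filter.Eventually.of_forall fun y => ?_)
  simp only [entry, if_pos hki]

theorem hasFDerivAt_varMatrix (hU : IsOpen U) (hUS : U ⊆ S n) (hp : IsPathFamily U p)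
    (i j : Idx n) {x : Pt n} (hx : x ∈ U) :
    HasFDerivAt (fun x' => varMatrix (fun j r => p j r x') x' i j)
      (∑ k, varMatrix (fun j r => p j r x) x k j • omega x i k) x := by
  have h := (hasFDerivAt_entry hU hUS hp i j hx).const_mul
    ((2 * (Real.pi : ℂ) * Complex.I) ^ j.card)
  refine h.congr_fderiv ?_
  rw [smul_sum]
  refine sum_congr rfl fun k _ => ?_
  rw [smul_smul]
  rfl

end EntryDeriv

/-! ### The columns as a fundamental system -/

section Fundamental

variable {n : ℕ} {U : Set (Pt n)} {p : Idx n → ℕ → Pt n → ℝ → ℂ}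

theorem varMatrix_eq_zero {i j : Idx n} (h : ¬j ⊆ i) (p : Idx n → ℕ → ℝ → ℂ) (x : Pt n) :
    varMatrix p x i j = 0 := by
  rw [varMatrix, of_apply, entry_of_not_subset h, mul_zero]

theorem varMatrix_self_ne_zero (p : Idx n → ℕ → ℝ → ℂ) (x : Pt n) (i : Idx n) :
    varMatrix p x i i ≠ 0 := by
  rw [varMatrix, of_apply, entry_self, mul_one]
  exact pow_ne_zero _ Complex.two_pi_I_ne_zero

theorem isUnit_varMatrix (p : Idx n → ℕ → ℝ → ℂ) (x : Pt n) : IsUnit (varMatrix p x) := by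
  rw [← mulVec_injective_iff_isUnit, ← coe_mulVecLin, injective_iff_map_eq_zero]
  intro c hc
  funext i
  induction i using Finset.strongInduction with
  | H i ih =>
    have h := congrFun hc i
    rw [mulVecLin_apply, mulVec, dotProduct, sum_eq_single i] at h
    · exact (mul_eq_zero.1 h).resolve_left (varMatrix_self_ne_zero p x i)
    · intro k _ hk
      by_cases hki : k ⊆ i
      · rw [ih k (hki.ssubset_of_ne hk), Pi.zero_apply, mul_zero]
      · rw [varMatrix_eq_zero hki, zero_mul]
    · simp

theorem IsSolution.sub {X Y : Pt n → Idx n → ℂ} (hX : IsSolution U X) (hY : IsSolution U Y) :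
    IsSolution U (fun x i => X x i - Y x i) := by
  intro x hx i
  refine ((hX x hx i).sub (hY x hx i)).congr_fderiv ?_
  rw [← sum_sub_distrib]
  simp only [form_sub_smul]

theorem IsSolution.sum_mul {X : Idx n → Pt n → Idx n → ℂ} (hX : ∀ j, IsSolution U (X j))
    (c : Idx n → ℂ) : IsSolution U (fun x i => ∑ j, X j x i * c j) := by
  intro x hx i
  refine (HasFDerivAt.fun_sum fun j _ => (hX j x hx i).mul_const (c j)).congr_fderiv ?_
  simp only [smul_sum, form_sum_smul, smul_smul]
  rw [sum_comm]
  simp only [mul_comm]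

/-- On a connected set a solution is determined by its value at one point: the components vanish
one weight after the other, since the differential of each involves only smaller ones. -/
theorem IsSolution.eq_zero (hU : IsOpen U) (hUc : IsPreconnected U) {X : Pt n → Idx n → ℂ}
    (hX : IsSolution U X) {x₀ : Pt n} (hx₀ : x₀ ∈ U) (h0 : X x₀ = 0) :
    ∀ i, ∀ x ∈ U, X x i = 0 := by
  intro i
  induction i using Finset.strongInduction with
  | H i ih =>
    intro x hx
    have hd : ∀ y ∈ U, HasFDerivAt (fun x' => X x' i) (0 : Form n) y := by
      intro y hy
      refine (hX y hy i).congr_fderiv ?_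
      rw [sum_smul_omega]
      refine sum_eq_zero fun k hk => ?_
      obtain ⟨h1, h2⟩ := (mem_filter.1 hk).2
      rw [ih k (h1.ssubset_of_ne (by rintro rfl; omega)) y hy, form_zero_smul]
    have h := hU.is_const_of_fderiv_eq_zero (𝕜 := ℂ) (f := fun x' => X x' i) hUc
      (fun y hy => (hd y hy).differentiableAt.differentiableWithinAt)
      (fun y hy => (hd y hy).fderiv) hx hx₀
    rw [h, h0, Pi.zero_apply]

theorem existsUnique_combination (hU : IsOpen U) (hUc : IsConnected U)
    {M : Pt n → Matrix (Idx n) (Idx n) ℂ} (hM : ∀ j, IsSolution U fun x i => M x i j)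
    (hunit : ∀ x ∈ U, IsUnit (M x)) {X : Pt n → Idx n → ℂ} (hX : IsSolution U X) :
    ∃! c : Idx n → ℂ, ∀ x ∈ U, X x = M x *ᵥ c := by
  obtain ⟨x₀, hx₀⟩ := hUc.nonempty
  obtain ⟨c, hc⟩ := (mulVec_surjective_iff_isUnit.2 (hunit x₀ hx₀)) (X x₀)
  refine ⟨c, fun x hx => ?_, fun c' hc' => ?_⟩
  · have hY := hX.sub (IsSolution.sum_mul hM c)
    funext i
    have := hY.eq_zero hU hUc.isPreconnected hx₀ (by
      funext i
      rw [Pi.zero_apply, sub_eq_zero, ← hc]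
      rfl) i x hx
    rw [sub_eq_zero] at this
    exact this
  · refine mulVec_injective_iff_isUnit.2 (hunit x₀ hx₀) ?_
    exact (hc' x₀ hx₀).symm.trans hc.symm

end Fundamental

/-! ### Existence and extension of paths -/

section Paths

open Filter Topology

/-- Two points of the plane outside a finite set are joined by a parabolic arc that avoids the
set. -/
theorem exists_path_avoiding {z₀ z₁ : ℂ} (hz : z₀ ≠ z₁) (F : Finset ℂ) (h0 : z₀ ∉ F)
    (h1 : z₁ ∉ F) : ∃ p : ℝ → ℂ, ContDiff ℝ 2 p ∧ p 0 = z₀ ∧ p 1 = z₁ ∧ ∀ t, p t ∉ F := by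
  have hne : z₁ - z₀ ≠ 0 := sub_ne_zero.2 hz.symm
  -- in the coordinate `w` with `w(z₀) = 0` and `w(z₁) = 1` the arc is `t + i τ t (1 - t)`, which
  -- determines `t = Re w` at a point of `F` and then `τ`
  let w : ℂ → ℂ := fun z => (z - z₀) / (z₁ - z₀)
  obtain ⟨τ, hτ⟩ := Infinite.exists_notMem_finset
    (F.image fun z => (w z).im / ((w z).re * (1 - (w z).re)))
  have hofReal : ContDiff ℝ 2 (fun t : ℝ => (t : ℂ)) := Complex.ofRealCLM.contDiff
  refine ⟨fun t => z₀ + (z₁ - z₀) * ((t : ℂ) + Complex.I * τ * t * (1 - t)), ?_, by simp, by simp,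
    fun t ht => ?_⟩
  · fun_prop
  · have hw : w (z₀ + (z₁ - z₀) * ((t : ℂ) + Complex.I * τ * t * (1 - t))) =
        (t : ℂ) + Complex.I * τ * t * (1 - t) := by
      simp only [w]
      field_simp
      ring
    have hre : ((t : ℂ) + Complex.I * τ * t * (1 - t)).re = t := by simp
    have him : ((t : ℂ) + Complex.I * τ * t * (1 - t)).im = τ * t * (1 - t) := by simp
    refine hτ (mem_image.2 ⟨_, ht, ?_⟩)
    simp only at ht
    rw [hw, hre, him]
    have ht0 : t ≠ 0 := by rintro rfl; simp at ht; exact h0 ht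
    have ht1 : 1 - t ≠ 0 := by
      intro h
      have : t = 1 := by linarith
      subst this
      simp at ht
      exact h1 ht
    field_simp

variable {n : ℕ}

theorem exists_isPathSystem {x : Pt n} (hx : x ∈ S n) : ∃ p, IsPathSystem x p := by
  have h : ∀ (j : Idx n) (r : ℕ), ∃ q : ℝ → ℂ, r ≤ j.card → ContDiff ℝ 2 q ∧
      q 0 = a x (place j r) ∧ q 1 = a x (place j (r + 1)) ∧
      ∀ t, q t ∉ (Ioo (place j r) (place j (r + 1))).image (a x) := by
    intro j r
    by_cases hr : r ≤ j.card
    swap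
    · exact ⟨0, fun h => absurd h hr⟩
    have hle := place_le_last j (r := r + 1) (by omega)
    obtain ⟨q, hq⟩ := exists_path_avoiding (a_place_ne hx j (lt_add_one r) (by omega))
      ((Ioo (place j r) (place j (r + 1))).image (a x))
      (by
        simp only [mem_image, mem_Ioo, not_exists, not_and]
        exact fun s hs => (a_ne hx hs.1 (by omega)).symm)
      (by
        simp only [mem_image, mem_Ioo, not_exists, not_and]
        exact fun s hs => a_ne hx hs.2 hle)
    exact ⟨q, fun _ => hq⟩
  choose p hp using h
  refine ⟨p, fun j r hr => (hp j r hr).1.contDiffOn, fun j r hr => (hp j r hr).2.1,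
    fun j r hr => (hp j r hr).2.2.1, fun j r hr t _ s hs1 hs2 heq => ?_⟩
  exact (hp j r hr).2.2.2 t (mem_image.2 ⟨s, mem_Ioo.2 ⟨hs1, hs2⟩, heq.symm⟩)

/-- The path `q`, which joins `a_s(x₀)` to `a_t(x₀)`, moved along with its end points. -/
def movePath (x₀ : Pt n) (s t : ℕ) (q : ℝ → ℂ) (x : Pt n) (u : ℝ) : ℂ :=
  q u + (1 - u) * (a x s - a x₀ s) + u * (a x t - a x₀ t)

theorem contDiffOn_a_fst (s : ℕ) (I : Set ℝ) :
    ContDiffOn ℝ 2 (fun z : Pt n × ℝ => a z.1 s) (S n ×ˢ I) := by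
  intro z hz
  have h : ContDiffAt ℝ 2 (fun x : Pt n => a x s) z.1 :=
    (contDiffAt_a (mem_S.1 hz.1).1 s).restrict_scalars ℝ
  exact (h.comp z contDiffAt_fst).contDiffWithinAt

theorem contDiffOn_movePath (x₀ : Pt n) (s t : ℕ) {q : ℝ → ℂ}
    (hq : ContDiffOn ℝ 2 q (Set.Icc 0 1)) :
    ContDiffOn ℝ 2 (fun z : Pt n × ℝ => movePath x₀ s t q z.1 z.2)
      (S n ×ˢ Set.Icc (0 : ℝ) 1) := by
  have h1 : ContDiffOn ℝ 2 (fun z : Pt n × ℝ => q z.2) (S n ×ˢ Set.Icc (0 : ℝ) 1) :=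
    hq.comp contDiffOn_snd fun z hz => hz.2
  have h2 : ContDiffOn ℝ 2 (fun z : Pt n × ℝ => (z.2 : ℂ)) (S n ×ˢ Set.Icc (0 : ℝ) 1) :=
    (Complex.ofRealCLM.contDiff.comp contDiff_snd).contDiffOn
  exact (h1.add ((contDiffOn_const.sub h2).mul ((contDiffOn_a_fst s _).sub contDiffOn_const))).add
    (h2.mul ((contDiffOn_a_fst t _).sub contDiffOn_const))

theorem movePath_self (x₀ : Pt n) (s t : ℕ) (q : ℝ → ℂ) (u : ℝ) :
    movePath x₀ s t q x₀ u = q u := by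
  simp [movePath]

theorem exists_isPathFamily {x₀ : Pt n} (hx₀ : x₀ ∈ S n) {p₀ : Idx n → ℕ → ℝ → ℂ}
    (hp₀ : IsPathSystem x₀ p₀) :
    ∃ U : Set (Pt n), IsOpen U ∧ x₀ ∈ U ∧ U ⊆ S n ∧
      ∃ p : Idx n → ℕ → Pt n → ℝ → ℂ, IsPathFamily U p ∧
        ∀ j, ∀ r ≤ j.card, ∀ t ∈ Set.Icc (0 : ℝ) 1, p j r x₀ t = p₀ j r t := by
  let p : Idx n → ℕ → Pt n → ℝ → ℂ := fun j r => movePath x₀ (place j r) (place j (r + 1)) (p₀ j r)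
  have hc : ∀ j, ∀ r ≤ j.card, ContDiffOn ℝ 2 (fun z : Pt n × ℝ => p j r z.1 z.2)
      (S n ×ˢ Set.Icc (0 : ℝ) 1) := fun j r hr => contDiffOn_movePath x₀ _ _ (hp₀.smooth j r hr)
  have hev : ∀ᶠ x in 𝓝 x₀, ∀ j : Idx n, ∀ r ∈ range (j.card + 1),
      ∀ s ∈ Ioo (place j r) (place j (r + 1)), ∀ t ∈ Set.Icc (0 : ℝ) 1,
        p j r x t - a x s ≠ 0 := by
    rw [eventually_all]
    intro j
    rw [eventually_all_finset]
    intro r hr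
    rw [eventually_all_finset]
    intro s hs
    have hr := mem_range.1 hr
    have hs := mem_Ioo.1 hs
    refine eventually_forall_mem_of_continuousOn (isOpen_S n) isOpen_ne
      (G := fun x t => p j r x t - a x s)
      ((hc j r (by omega)).continuousOn.sub (contDiffOn_a_fst s _).continuousOn) hx₀ ?_
    intro t ht
    simp only [p, movePath_self]
    exact sub_ne_zero.2 (hp₀.avoid j r (by omega) t ht s hs.1 hs.2)
  obtain ⟨U, hU, hUo, hxU⟩ := eventually_nhds_iff.1 (hev.and ((isOpen_S n).eventually_mem hx₀))
  have hUS : U ⊆ S n := fun x hx => (hU x hx).2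
  refine ⟨U, hUo, hxU, hUS, p, ⟨fun x hx => ⟨?_, ?_, ?_, ?_⟩, ?_⟩, ?_⟩
  · intro j r hr
    exact (hc j r hr).comp (f := fun t : ℝ => (x, t)) (by fun_prop) fun t ht => ⟨hUS hx, ht⟩
  · intro j r hr
    simp [p, movePath, hp₀.source j r hr]
  · intro j r hr
    simp [p, movePath, hp₀.target j r hr]
  · intro j r hr t ht s hs1 hs2
    exact sub_ne_zero.1 ((hU x hx).1 j r (mem_range.2 (by omega)) s (mem_Ioo.2 ⟨hs1, hs2⟩) t ht)
  · exact fun j r hr => (hc j r hr).mono (Set.prod_mono hUS subset_rfl)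
  · exact fun j r _ t _ => movePath_self x₀ _ _ _ t

end Paths

/-! ### Integrability of the connection form -/

section Integrable

open Filter Topology

variable {n : ℕ}

theorem omega_eq_or (i k : Idx n) :
    (∀ x, omega x i k = 0) ∨ ∃ m < i.card, k = dropAt i (m + 1) := by
  by_cases h : k ⊆ i ∧ k.card + 1 = i.card
  · obtain ⟨s, h1, h2, rfl⟩ := exists_eq_dropAt h.1 h.2
    obtain ⟨m, rfl⟩ := Nat.exists_eq_add_of_le' h1
    exact Or.inr ⟨m, h2, rfl⟩
  · exact Or.inl (omega_eq_zero h)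

theorem differentiableAt_dlog {f : Pt n → ℂ} {x : Pt n} (hf : ContDiffAt ℂ 2 f x) (h0 : f x ≠ 0) :
    DifferentiableAt ℂ (dlog f) x :=
  ((hf.differentiableAt (by simp)).inv h0).smul
    ((hf.fderiv_right (m := 1) (by norm_num)).differentiableAt (by simp))

theorem differentiableAt_omega (i k : Idx n) {x : Pt n} (hx : x ∈ S n) :
    DifferentiableAt ℂ (fun x => omega x i k) x := by
  rcases omega_eq_or i k with h | ⟨m, hm, rfl⟩
  · simp only [h]
    exact differentiableAt_const _
  · simp only [omega_dropAt i hm]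
    exact (differentiableAt_dlog (contDiffAt_ratio hx i hm) (ratio_ne_zero hx i hm)).neg

/-- Near a point where `f` is not zero the form `df / f` is the differential of a branch of the
logarithm of `f`. -/
theorem exists_primitive_dlog {f : Pt n → ℂ} {x : Pt n} (hf : ContDiffAt ℂ 2 f x)
    (h0 : f x ≠ 0) :
    ∃ g : Pt n → ℂ, ContDiffAt ℂ 2 g x ∧ ∀ᶠ y in 𝓝 x, HasFDerivAt g (dlog f y) y := by
  have hs : f x / f x ∈ Complex.slitPlane := by rw [div_self h0]; simp
  refine ⟨fun y => Complex.log (f y / f x), 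
    (Complex.contDiffAt_log hs).comp (f := fun y => f y / f x) x (hf.div_const _), ?_⟩
  have h1 : ∀ᶠ y in 𝓝 x, DifferentiableAt ℂ f y :=
    (hf.eventually (by simp)).mono fun y hy => hy.differentiableAt (by simp)
  have h2 : ∀ᶠ y in 𝓝 x, f y / f x ∈ Complex.slitPlane :=
    (hf.continuousAt.div_const _).eventually (Complex.isOpen_slitPlane.mem_nhds hs)
  filter_upwards [h1, h2] with y hy1 hy2
  refine ((hy1.hasFDerivAt.mul_const (f x)⁻¹).clog hy2).congr_fderiv ?_
  have hy0 : f y ≠ 0 := by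
    intro h
    rw [h, zero_div] at hy2
    simp at hy2
  ext v
  simp [dlog]
  field_simp

theorem exists_primitive_omega (i k : Idx n) {x : Pt n} (hx : x ∈ S n) :
    ∃ g : Pt n → ℂ, ContDiffAt ℂ 2 g x ∧ ∀ᶠ y in 𝓝 x, HasFDerivAt g (omega y i k) y := by
  rcases omega_eq_or i k with h | ⟨m, hm, rfl⟩
  · simp only [h]
    exact ⟨fun _ => 0, contDiffAt_const, Eventually.of_forall fun y => hasFDerivAt_const _ _⟩
  · obtain ⟨g, hg, hd⟩ := exists_primitive_dlog (contDiffAt_ratio hx i hm) (ratio_ne_zero hx i hm)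
    refine ⟨fun y => -g y, hg.neg, hd.mono fun y hy => ?_⟩
    rw [omega_dropAt i hm]
    exact hy.neg

theorem extDeriv_asAlt_eq_zero {η : Pt n → Form n} {g : Pt n → ℂ} {x : Pt n}
    (hg : ContDiffAt ℂ 2 g x) (h : ∀ᶠ y in 𝓝 x, HasFDerivAt g (η y) y) :
    extDeriv (asAlt η) x = 0 := by
  have e : asAlt η =ᶠ[𝓝 x]
      extDeriv fun y => ContinuousAlternatingMap.constOfIsEmpty ℂ (Pt n) (Fin 0) (g y) := by
    filter_upwards [h] with y hy
    rw [extDeriv_constOfIsEmpty, hy.fderiv]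
    rfl
  rw [e.extDeriv_eq]
  refine extDeriv_extDeriv_apply (r := 2) ?_ (by simp)
  exact (ContinuousAlternatingMap.constOfIsEmptyLIE ℂ (Pt n) ℂ
    (Fin 0)).contDiff.contDiffAt.comp x hg

theorem fderiv_omega_symm (i k : Idx n) {x : Pt n} (hx : x ∈ S n) (v w : Pt n) :
    fderiv ℂ (fun y => omega y i k) x v w = fderiv ℂ (fun y => omega y i k) x w v := by
  obtain ⟨g, _, hd⟩ := exists_primitive_omega i k hx
  exact second_derivative_symmetric_of_eventually hd
    (differentiableAt_omega i k hx).hasFDerivAt v w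

/-- The second differential of a solution `X` is symmetric, and so is that of each entry of `ω`,
since these are closed. Hence `ω ∧ ω` annihilates `X`. -/
theorem IsSolution.omegaAt_comm_mulVec {U : Set (Pt n)} (hU : IsOpen U) (hUS : U ⊆ S n)
    {X : Pt n → Idx n → ℂ} (hX : IsSolution U X) {x : Pt n} (hx : x ∈ U) (v w : Pt n) :
    (omegaAt x v * omegaAt x w - omegaAt x w * omegaAt x v) *ᵥ X x = 0 := by
  have hsymm : ∀ i, ∑ k, ((∑ l, X x l * omega x k l v) * omega x i k w +
        X x k * fderiv ℂ (fun y => omega y i k) x v w) =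
      ∑ k, ((∑ l, X x l * omega x k l w) * omega x i k v +
        X x k * fderiv ℂ (fun y => omega y i k) x w v) := by
    intro i
    have h1 : ∀ᶠ y in 𝓝 x, HasFDerivAt (fun x' => X x' i) (∑ k, X y k • omega y i k) y :=
      (hU.eventually_mem hx).mono fun y hy => hX y hy i
    have h2 : HasFDerivAt (fun y => ∑ k, X y k • omega y i k) _ x :=
      HasFDerivAt.fun_sum fun k _ =>
        (hX x hx k).smul (differentiableAt_omega i k (hUS hx)).hasFDerivAt
    have h3 := second_derivative_symmetric_of_eventually h1 h2 v w
    simpa [add_comm] using h3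
  funext i
  have h := hsymm i
  simp only [sum_add_distrib, fderiv_omega_symm _ _ (hUS hx) v w] at h
  have h := add_right_cancel h
  rw [sub_mulVec, ← mulVec_mulVec, ← mulVec_mulVec, Pi.sub_apply, Pi.zero_apply, sub_eq_zero]
  simp only [mulVec, dotProduct, omegaAt, of_apply]
  simp only [mul_comm] at h ⊢
  exact h.symm

/-- Locally there is a branch, the columns of which form an invertible matrix annihilated by
`ω ∧ ω`. -/
theorem omegaAt_comm {x : Pt n} (hx : x ∈ S n) (v w : Pt n) :
    omegaAt x v * omegaAt x w - omegaAt x w * omegaAt x v = 0 := by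
  obtain ⟨p₀, hp₀⟩ := exists_isPathSystem hx
  obtain ⟨U, hU, hxU, hUS, p, hp, _⟩ := exists_isPathFamily hx hp₀
  have h0 : (omegaAt x v * omegaAt x w - omegaAt x w * omegaAt x v) *
      varMatrix (fun j r => p j r x) x = 0 := by
    ext i j
    exact congrFun (IsSolution.omegaAt_comm_mulVec hU hUS
      (X := fun x i => varMatrix (fun j r => p j r x) x i j)
      (fun y hy i => hasFDerivAt_varMatrix hU hUS hp i j hy) hxU v w) i
  exact (isUnit_varMatrix _ x).mul_left_eq_zero.1 h0

end Integrable

/-! ### Logarithmic differentials -/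

section Dlog

open Filter Topology

variable {n : ℕ}

theorem dlog_mul {f g : Pt n → ℂ} {x : Pt n} (hf : DifferentiableAt ℂ f x)
    (hg : DifferentiableAt ℂ g x) (hf0 : f x ≠ 0) (hg0 : g x ≠ 0) :
    dlog (fun y => f y * g y) x = dlog f x + dlog g x := by
  have h : HasFDerivAt (fun y => f y * g y) _ x := hf.hasFDerivAt.mul hg.hasFDerivAt
  rw [dlog, h.fderiv, dlog, dlog]
  ext v
  simp
  field_simp
  ring

theorem dlog_div {f g : Pt n → ℂ} {x : Pt n} (hf : DifferentiableAt ℂ f x)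
    (hg : DifferentiableAt ℂ g x) (hf0 : f x ≠ 0) (hg0 : g x ≠ 0) :
    dlog (fun y => f y / g y) x = dlog f x - dlog g x :=
  dlog_div_apply hf.hasFDerivAt hg.hasFDerivAt hf0 hg0

theorem dlog_neg (f : Pt n → ℂ) (x : Pt n) : dlog (fun y => -f y) x = dlog f x := by
  rw [dlog, dlog, fderiv_fun_neg]
  ext v
  simp [inv_neg]

theorem dlog_const (c : ℂ) (x : Pt n) : dlog (fun _ : Pt n => c) x = 0 := by
  rw [dlog, fderiv_fun_const]
  ext v
  simp

theorem dlog_prod {ι : Type*} (s : Finset ι) {f : ι → Pt n → ℂ} {x : Pt n}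
    (hf : ∀ i ∈ s, DifferentiableAt ℂ (f i) x) (h0 : ∀ i ∈ s, f i x ≠ 0) :
    dlog (fun y => ∏ i ∈ s, f i y) x = ∑ i ∈ s, dlog (f i) x := by
  classical
  induction s using Finset.induction_on with
  | empty => simp [dlog_const]
  | insert i s hi ih =>
    simp only [prod_insert hi, sum_insert hi]
    rw [dlog_mul (hf i (mem_insert_self _ _)), ih]
    · exact fun j hj => hf j (mem_insert_of_mem hj)
    · exact fun j hj => h0 j (mem_insert_of_mem hj)
    · exact (HasFDerivAt.finsetProd fun j hj =>
        (hf j (mem_insert_of_mem hj)).hasFDerivAt).differentiableAt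
    · exact h0 i (mem_insert_self _ _)
    · exact prod_ne_zero_iff.2 fun j hj => h0 j (mem_insert_of_mem hj)

theorem dlog_congr {f g : Pt n → ℂ} {x : Pt n} (h : f =ᶠ[𝓝 x] g) : dlog f x = dlog g x := by
  rw [dlog, dlog, h.fderiv_eq, h.eq_of_nhds]

/-- The equation `1 - x_s ⋯ x_t` of a component of the divisor. -/
def gap (s t : Fin n) (x : Pt n) : ℂ := 1 - ∏ α ∈ Icc s t, x α

theorem differentiable_gap (s t : Fin n) : Differentiable ℂ (gap s t) := by
  unfold gap; fun_prop

/-- The `1`-form `η` is on `S_n` an integral linear combination of the logarithmic differentials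
of the equations of the components of the divisor. -/
def IsIntegralComb (η : Pt n → Form n) : Prop :=
  ∃ (e : Fin n → ℤ) (f : Fin n → Fin n → ℤ), ∀ x ∈ S n,
    η x = ∑ s, e s • dlog (fun x' : Pt n => x' s) x +
      ∑ s, ∑ t ∈ univ.filter (fun t => s ≤ t),
        f s t • dlog (fun x' : Pt n => 1 - ∏ α ∈ Icc s t, x' α) x

namespace IsIntegralComb

theorem congr {η ξ : Pt n → Form n} (hη : IsIntegralComb η) (h : ∀ x ∈ S n, ξ x = η x) :
    IsIntegralComb ξ := by
  obtain ⟨e, f, hef⟩ := hη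
  exact ⟨e, f, fun x hx => (h x hx).trans (hef x hx)⟩

theorem zero : IsIntegralComb (fun _ : Pt n => (0 : Form n)) :=
  ⟨0, 0, fun x _ => by simp⟩

theorem add {η ξ : Pt n → Form n} (hη : IsIntegralComb η) (hξ : IsIntegralComb ξ) :
    IsIntegralComb (fun x => η x + ξ x) := by
  obtain ⟨e, f, h⟩ := hη
  obtain ⟨e', f', h'⟩ := hξ
  refine ⟨e + e', f + f', fun x hx => ?_⟩
  simp only [h x hx, h' x hx, Pi.add_apply, form_add_zsmul, sum_add_distrib]
  abel

theorem neg {η : Pt n → Form n} (hη : IsIntegralComb η) : IsIntegralComb (fun x => -η x) := by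
  obtain ⟨e, f, h⟩ := hη
  refine ⟨-e, -f, fun x hx => ?_⟩
  simp only [h x hx, Pi.neg_apply, neg_smul, sum_neg_distrib]
  abel

theorem sum {ι : Type*} (s : Finset ι) {η : ι → Pt n → Form n}
    (hη : ∀ i, IsIntegralComb (η i)) : IsIntegralComb (fun x => ∑ i ∈ s, η i x) := by
  classical
  induction s using Finset.induction_on with
  | empty => simpa using zero
  | insert i s hi ih =>
    simp only [sum_insert hi]
    exact (hη i).add ih

theorem dlog_coord (s : Fin n) : IsIntegralComb (dlog fun x : Pt n => x s) := by
  refine ⟨Pi.single s 1, 0, fun x _ => ?_⟩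
  rw [sum_eq_single s]
  · simp
  · intro t _ h
    rw [Pi.single_eq_of_ne h]
    ext v
    simp
  · simp

theorem dlog_gap {s t : Fin n} (hst : s ≤ t) : IsIntegralComb (dlog (gap s t)) := by
  refine ⟨0, fun s' t' => if s' = s ∧ t' = t then 1 else 0, fun x _ => ?_⟩
  have h0 : ∑ s' : Fin n, (0 : Fin n → ℤ) s' • dlog (fun x' : Pt n => x' s') x = 0 := by simp
  rw [h0, zero_add, sum_eq_single s, sum_eq_single t]
  · ext v
    simp
    rfl
  · intro t' _ h
    ext v
    simp [h]
  · intro h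
    simp [hst] at h
  · intro s' _ h
    refine sum_eq_zero fun t' _ => ?_
    ext v
    simp [h]
  · simp

end IsIntegralComb

theorem gap_ne_zero {x : Pt n} (hx : x ∈ S n) {s t : Fin n} (hst : s ≤ t) : gap s t x ≠ 0 :=
  (mem_S.1 hx).2 s t hst

/-- With consecutive places `s < t < u` of ones of `i` the entry of `ω` is the logarithmic
differential of the ratio `- x_s ⋯ x_{t-1} (1 - x_t ⋯ x_{u-1}) / (1 - x_s ⋯ x_{t-1})`, and
of `1 - x_t ⋯ x_{u-1}` if `s = 0`. -/
theorem isIntegralComb_dlog_ratio (i : Idx n) {m : ℕ} (hm : m < i.card) :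
    IsIntegralComb (dlog (ratio i m)) := by
  have l1 := place_lt_succ i (r := m) (by omega)
  have l2 : place i (m + 1) < place i (m + 2) := place_lt_succ i (by omega)
  have l3 := place_le_last i (r := m + 2) (by omega)
  have hev : ∀ x ∈ S n, ∀ᶠ y in 𝓝 x, y ∈ S n := fun x hx => (isOpen_S n).eventually_mem hx
  set t₀ : Fin n := ⟨place i (m + 1) - 1, by omega⟩ with ht₀
  set t₁ : Fin n := ⟨place i (m + 2) - 2, by omega⟩ with ht₁
  have ht : t₀ ≤ t₁ := by simp [ht₀, ht₁, Fin.le_def]; omega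
  have hX : ∀ y ∈ S n, a y (place i (m + 2)) = a y (place i (m + 1)) * ∏ α ∈ Icc t₀ t₁, y α :=
    fun y hy => a_eq_mul (mem_S.1 hy).1 (by omega) l2 l3
  have hne : ∀ y ∈ S n, a y (place i (m + 1)) ≠ 0 := fun y hy =>
    a_ne_zero (mem_S.1 hy).1 (by omega)
  rcases Nat.eq_zero_or_pos m with rfl | h0
  · refine (IsIntegralComb.dlog_gap ht).congr fun x hx => dlog_congr ?_
    filter_upwards [hev x hx] with y hy
    have := hne y hy
    rw [ratio, hX y hy, gap, place_zero, a_zero]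
    field_simp
    ring
  · have h0' : 0 < place i m := by simpa using place_lt i h0 (by omega)
    set s₀ : Fin n := ⟨place i m - 1, by omega⟩ with hs₀
    set s₁ : Fin n := ⟨place i (m + 1) - 2, by omega⟩ with hs₁
    have hs : s₀ ≤ s₁ := by simp [hs₀, hs₁, Fin.le_def]; omega
    have hX' : ∀ y ∈ S n, a y (place i (m + 1)) = a y (place i m) * ∏ α ∈ Icc s₀ s₁, y α :=
      fun y hy => a_eq_mul (mem_S.1 hy).1 (by omega) l1 (by omega)
    refine (((IsIntegralComb.sum (Icc s₀ s₁) IsIntegralComb.dlog_coord).add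
      (IsIntegralComb.dlog_gap ht)).add (IsIntegralComb.dlog_gap hs).neg).congr fun x hx => ?_
    have hx0 := (mem_S.1 hx).1
    have e : ratio i m =ᶠ[𝓝 x] fun y =>
        -(((∏ α ∈ Icc s₀ s₁, y α) * gap t₀ t₁ y) / gap s₀ s₁ y) := by
      filter_upwards [hev x hx] with y hy
      have h1 := a_ne_zero (mem_S.1 hy).1 (s := place i m) (by omega)
      have h2 : 1 - ∏ α ∈ Icc s₀ s₁, y α ≠ 0 := gap_ne_zero hy hs
      rw [ratio, hX y hy, hX' y hy, gap, gap]
      have h3 : a y (place i m) - a y (place i m) * ∏ α ∈ Icc s₀ s₁, y α =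
          a y (place i m) * (1 - ∏ α ∈ Icc s₀ s₁, y α) := by ring
      rw [h3]
      field_simp
      ring
    rw [dlog_congr e, dlog_neg, dlog_div, dlog_mul, dlog_prod, sub_eq_add_neg]
    · intro α _; fun_prop
    · exact fun α _ => hx0 α
    · fun_prop
    · exact differentiable_gap _ _ _
    · exact prod_ne_zero_iff.2 fun α _ => hx0 α
    · exact gap_ne_zero hx ht
    · exact DifferentiableAt.mul (by fun_prop) (differentiable_gap _ _ _)
    · exact differentiable_gap _ _ _
    · exact mul_ne_zero (prod_ne_zero_iff.2 fun α _ => hx0 α) (gap_ne_zero hx ht)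
    · exact gap_ne_zero hx hs

theorem isIntegralComb_omega (i k : Idx n) : IsIntegralComb (fun x => omega x i k) := by
  rcases omega_eq_or i k with h | ⟨m, hm, rfl⟩
  · exact IsIntegralComb.zero.congr fun x _ => h x
  · exact (isIntegralComb_dlog_ratio i hm).neg.congr fun x _ => omega_dropAt i hm x

end Dlog

/-! ### Logarithmic poles on projective space -/

section Projective

open Filter Topology

variable {n : ℕ}

/-- The equation `X_0^{t-s+1} - X_s ⋯ X_t` of the closure of a component of the divisor in the
`m`-th chart. -/
def homogGap (m : Fin (n + 1)) (s t : Fin n) (u : Pt n) : ℂ :=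
  homog m u 0 ^ (Icc s t).card - ∏ α ∈ Icc s t, homog m u α.succ

theorem contDiff_homog (m k : Fin (n + 1)) {r : WithTop ℕ∞} :
    ContDiff ℂ r (fun u : Pt n => homog m u k) := by
  unfold homog
  by_cases h : k = m
  · subst h
    simp only [Fin.insertNth_apply_same]
    exact contDiff_const
  · obtain ⟨j, rfl⟩ := Fin.exists_succAbove_eq h
    simp only [Fin.insertNth_apply_succAbove]
    exact contDiff_apply ℂ ℂ j

theorem contDiff_homogGap (m : Fin (n + 1)) (s t : Fin n) {r : WithTop ℕ∞} :
    ContDiff ℂ r (homogGap m s t) :=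
  ((contDiff_homog m 0).pow _).sub (contDiff_prod fun _ _ => contDiff_homog m _)

theorem divisorEq_ne_zero {m : Fin (n + 1)} {u : Pt n} :
    divisorEq m u ≠ 0 ↔ (homog m u 0 ≠ 0 ∧ ∀ j : Fin n, homog m u j.succ ≠ 0) ∧
      ∀ s t, s ≤ t → homogGap m s t u ≠ 0 := by
  simp only [divisorEq, mul_ne_zero_iff, prod_ne_zero_iff, mem_univ, true_imp_iff, mem_filter,
    true_and, homogGap]

theorem gap_toAffine {m : Fin (n + 1)} {u : Pt n} (h0 : homog m u 0 ≠ 0) (s t : Fin n) :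
    gap s t (toAffine m u) = homogGap m s t u / homog m u 0 ^ (Icc s t).card := by
  simp only [gap, toAffine, homogGap, prod_div_distrib, prod_const]
  field_simp

theorem toAffine_mem_S {m : Fin (n + 1)} {u : Pt n} (h : divisorEq m u ≠ 0) :
    toAffine m u ∈ S n := by
  obtain ⟨⟨h0, h1⟩, h2⟩ := divisorEq_ne_zero.1 h
  refine mem_S.2 ⟨fun j => div_ne_zero (h1 j) h0, fun s t hst => ?_⟩
  have := gap_toAffine h0 s t
  rw [gap] at this
  rw [this]
  exact div_ne_zero (h2 s t hst) (pow_ne_zero _ h0)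

theorem contDiffAt_toAffine {m : Fin (n + 1)} {u : Pt n} (h0 : homog m u 0 ≠ 0)
    {r : WithTop ℕ∞} : ContDiffAt ℂ r (toAffine m) u :=
  contDiffAt_pi.2 fun j => (contDiff_homog m j.succ).contDiffAt.div
    (contDiff_homog m 0).contDiffAt h0

theorem differentiableAt_toAffine {m : Fin (n + 1)} {u : Pt n} (h0 : homog m u 0 ≠ 0) :
    DifferentiableAt ℂ (toAffine m) u :=
  (contDiffAt_toAffine h0 (r := 1)).differentiableAt (by simp)

theorem extDeriv_inChart_omega (i k : Idx n) {m : Fin (n + 1)} {u : Pt n}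
    (h : divisorEq m u ≠ 0) :
    extDeriv (asAlt (inChart m fun x => omega x i k)) u = 0 := by
  obtain ⟨g, hg, hd⟩ := exists_primitive_omega i k (toAffine_mem_S h)
  have h0 := (divisorEq_ne_zero.1 h).1.1
  refine extDeriv_asAlt_eq_zero (g := g ∘ toAffine m) (hg.comp u (contDiffAt_toAffine h0)) ?_
  have h1 : ∀ᶠ v in 𝓝 u, homog m v 0 ≠ 0 :=
    (contDiff_homog m 0 (r := 0)).continuous.continuousAt.eventually_ne h0
  filter_upwards [h1, (differentiableAt_toAffine h0).continuousAt.eventually hd] with v hv hv'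
  exact hv'.comp v (differentiableAt_toAffine hv).hasFDerivAt

/-- The product of the function `h` and the `1`-form `η`, given where `h` is not zero, extends to
a holomorphic form. -/
def ExtendsMul (h : Pt n → ℂ) (η : Pt n → Form n) : Prop :=
  ∃ α : Pt n → Form n, Differentiable ℂ α ∧ ∀ u, h u ≠ 0 → h u • η u = α u

namespace ExtendsMul

variable {h : Pt n → ℂ}

theorem congr {η ξ : Pt n → Form n} (hη : ExtendsMul h η) (e : ∀ u, h u ≠ 0 → ξ u = η u) :
    ExtendsMul h ξ := by
  obtain ⟨α, hα, H⟩ := hη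
  exact ⟨α, hα, fun u hu => by rw [e u hu, H u hu]⟩

theorem add {η ξ : Pt n → Form n} (hη : ExtendsMul h η) (hξ : ExtendsMul h ξ) :
    ExtendsMul h (fun u => η u + ξ u) := by
  obtain ⟨α, hα, H⟩ := hη
  obtain ⟨β, hβ, H'⟩ := hξ
  exact ⟨fun u => α u + β u, hα.add hβ, fun u hu => by
    simp only [← H u hu, ← H' u hu, smul_add]⟩

theorem zsmul {η : Pt n → Form n} (hη : ExtendsMul h η) (c : ℤ) :
    ExtendsMul h (fun u => c • η u) := by
  obtain ⟨α, hα, H⟩ := hη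
  refine ⟨fun u => (c : ℂ) • α u, hα.fun_const_smul _, fun u hu => ?_⟩
  simp only [← H u hu]
  ext v
  simp
  ring

theorem sum {ι : Type*} (s : Finset ι) {η : ι → Pt n → Form n}
    (hη : ∀ i ∈ s, ExtendsMul h (η i)) : ExtendsMul h (fun u => ∑ i ∈ s, η i u) := by
  classical
  induction s using Finset.induction_on with
  | empty =>
    refine ⟨fun _ => 0, differentiable_const _, fun u _ => ?_⟩
    ext v
    simp
  | insert i s hi ih =>
    simp only [sum_insert hi]
    exact (hη i (mem_insert_self _ _)).add (ih fun j hj => hη j (mem_insert_of_mem hj))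

/-- The logarithmic differential of a factor of `h` has at most a simple pole along `h = 0`. -/
theorem dlog_factor {f g : Pt n → ℂ} (hf : ContDiff ℂ 2 f) (hg : Differentiable ℂ g)
    (e : ∀ u, h u = f u * g u) : ExtendsMul h (dlog f) := by
  refine ⟨fun u => g u • fderiv ℂ f u,
    hg.smul ((hf.fderiv_right (m := 1) (by norm_num)).differentiable (by simp)), fun u hu => ?_⟩
  have hfu : f u ≠ 0 := by
    intro h0
    rw [e, h0, zero_mul] at hu
    exact hu rfl
  rw [e, dlog]
  ext v
  simp
  field_simp

end ExtendsMul

theorem extendsMul_dlog_homog (m k : Fin (n + 1)) :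
    ExtendsMul (divisorEq m) (dlog fun u : Pt n => homog m u k) := by
  have hd := fun k => (contDiff_homog (n := n) m k (r := 1)).differentiable (by simp)
  have hg := fun s t => (contDiff_homogGap (n := n) m s t (r := 1)).differentiable (by simp)
  have hP : Differentiable ℂ fun u : Pt n => ∏ s : Fin n, ∏ t ∈ univ.filter (fun t => s ≤ t),
      homogGap m s t u := fun u => by
    have : ContDiff ℂ 1 fun u : Pt n => ∏ s : Fin n, ∏ t ∈ univ.filter (fun t => s ≤ t),
      homogGap m s t u := contDiff_prod fun s _ => contDiff_prod fun t _ => contDiff_homogGap m s t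
    exact this.differentiable (by simp) u
  have hQ : ∀ T : Finset (Fin n), Differentiable ℂ fun u : Pt n => ∏ j ∈ T, homog m u j.succ :=
    fun T => (contDiff_prod fun j _ => contDiff_homog m j.succ (r := 1)).differentiable (by simp)
  refine Fin.cases ?_ (fun j => ?_) k
  · refine ExtendsMul.dlog_factor (contDiff_homog m 0) ((hQ univ).mul hP) fun u => ?_
    simp only [divisorEq, homogGap, Pi.mul_apply]
    ring
  · refine ExtendsMul.dlog_factor (contDiff_homog m j.succ)
      (((hd 0).mul (hQ (univ.erase j))).mul hP) fun u => ?_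
    simp only [divisorEq, homogGap, Pi.mul_apply]
    rw [← mul_prod_erase univ (fun j : Fin n => homog m u j.succ) (mem_univ j)]
    ring

theorem extendsMul_dlog_homogGap (m : Fin (n + 1)) {s t : Fin n} (hst : s ≤ t) :
    ExtendsMul (divisorEq m) (dlog (homogGap m s t)) := by
  have hg : ContDiff ℂ 1 fun u : Pt n => (homog m u 0 * ∏ j : Fin n, homog m u j.succ) *
      ((∏ t' ∈ (univ.filter fun t' => s ≤ t').erase t, homogGap m s t' u) *
        ∏ s' ∈ univ.erase s, ∏ t' ∈ univ.filter (fun t' => s' ≤ t'), homogGap m s' t' u) :=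
    ((contDiff_homog m 0).mul (contDiff_prod fun j _ => contDiff_homog m j.succ)).mul
      ((contDiff_prod fun t' _ => contDiff_homogGap m s t').mul
        (contDiff_prod fun s' _ => contDiff_prod fun t' _ => contDiff_homogGap m s' t'))
  refine ExtendsMul.dlog_factor (contDiff_homogGap m s t) (hg.differentiable (by simp))
    fun u => ?_
  have e : divisorEq m u = homog m u 0 * (∏ j : Fin n, homog m u j.succ) *
      ∏ s : Fin n, ∏ t ∈ univ.filter (fun t => s ≤ t), homogGap m s t u := rfl
  rw [e, ← mul_prod_erase univ (fun s => ∏ t ∈ univ.filter (fun t => s ≤ t), homogGap m s t u)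
      (mem_univ s),
    ← mul_prod_erase (univ.filter fun t' => s ≤ t') _ (mem_filter.2 ⟨mem_univ t, hst⟩)]
  ring

theorem inChart_dlog {m : Fin (n + 1)} {f : Pt n → ℂ} {u : Pt n} (h0 : homog m u 0 ≠ 0)
    (hf : DifferentiableAt ℂ f (toAffine m u)) :
    inChart m (dlog f) u = dlog (fun v => f (toAffine m v)) u := by
  have h := hf.hasFDerivAt.comp u (differentiableAt_toAffine h0).hasFDerivAt
  have h' : fderiv ℂ (fun v => f (toAffine m v)) u = _ := h.fderiv
  rw [dlog, h']
  rfl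

theorem extendsMul_inChart_coord (m : Fin (n + 1)) (s : Fin n) :
    ExtendsMul (divisorEq m) (inChart m (dlog fun x : Pt n => x s)) := by
  refine ((extendsMul_dlog_homog m s.succ).add ((extendsMul_dlog_homog m 0).zsmul (-1))).congr
    fun u hu => ?_
  obtain ⟨⟨h0, h1⟩, h2⟩ := divisorEq_ne_zero.1 hu
  have hd := fun k => (contDiff_homog (n := n) m k (r := 1)).differentiable (by simp)
  rw [inChart_dlog h0 (by fun_prop)]
  simp only [toAffine]
  rw [dlog_div (hd _ u) (hd _ u) (h1 s) h0]
  simp [sub_eq_add_neg]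

theorem extendsMul_inChart_gap (m : Fin (n + 1)) {s t : Fin n} (hst : s ≤ t) :
    ExtendsMul (divisorEq m) (inChart m (dlog (gap s t))) := by
  refine ((extendsMul_dlog_homogGap m hst).add
    (ExtendsMul.sum (Icc s t) fun _ _ => (extendsMul_dlog_homog m 0).zsmul (-1))).congr
    fun u hu => ?_
  obtain ⟨⟨h0, h1⟩, h2⟩ := divisorEq_ne_zero.1 hu
  have hd := fun k => (contDiff_homog (n := n) m k (r := 1)).differentiable (by simp)
  have hg := fun s t => (contDiff_homogGap (n := n) m s t (r := 1)).differentiable (by simp)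
  have e : (fun v => gap s t (toAffine m v)) =ᶠ[𝓝 u]
      fun v => homogGap m s t v / ∏ _α ∈ Icc s t, homog m v 0 := by
    filter_upwards [(hd 0 u).continuousAt.eventually_ne h0] with v hv
    rw [gap_toAffine hv, prod_const]
  rw [inChart_dlog h0 (differentiable_gap _ _ _), dlog_congr e, dlog_div, dlog_prod]
  · simp [sub_eq_add_neg]
  · exact fun _ _ => hd 0 u
  · exact fun _ _ => h0
  · exact hg s t u
  · exact (contDiff_prod fun _ _ => contDiff_homog m 0 (r := 1)).differentiable (by simp) u
  · exact h2 s t hst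
  · exact prod_ne_zero_iff.2 fun _ _ => h0

theorem hasLogPoles_omega (i k : Idx n) (m : Fin (n + 1)) :
    HasLogPoles (divisorEq m) (inChart m fun x => omega x i k) := by
  constructor
  · obtain ⟨e, f, h⟩ := isIntegralComb_omega i k
    have key : ExtendsMul (divisorEq m) fun u =>
        ∑ s, e s • inChart m (dlog fun x : Pt n => x s) u +
          ∑ s, ∑ t ∈ univ.filter (fun t => s ≤ t), f s t • inChart m (dlog (gap s t)) u :=
      (ExtendsMul.sum _ fun s _ => (extendsMul_inChart_coord m s).zsmul _).add
        (ExtendsMul.sum _ fun s _ => ExtendsMul.sum _ fun t ht =>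
          (extendsMul_inChart_gap m (mem_filter.1 ht).2).zsmul _)
    refine key.congr fun u hu => ?_
    have hu' := h _ (toAffine_mem_S hu)
    simp only at hu'
    ext v
    simp [inChart, hu']
    rfl
  · refine ⟨0, differentiable_const _, fun u hu => ?_⟩
    rw [extDeriv_inChart_omega i k hu]
    ext v
    simp

end Projective

end MultiLog

end

theorem mainTheorem5 (n : ℕ) :
    -- choices of paths exist at every point, and every choice of paths at a point belongs to a
    -- smooth choice near that point, that is, to a branch of the multi-valued matrix
    (∀ x₀ ∈ S n, ∃ p : Idx n → ℕ → ℝ → ℂ, IsPathSystem x₀ p) ∧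
    (∀ x₀ ∈ S n, ∀ p₀ : Idx n → ℕ → ℝ → ℂ, IsPathSystem x₀ p₀ →
      ∃ U : Set (Pt n), IsOpen U ∧ x₀ ∈ U ∧ U ⊆ S n ∧
        ∃ p : Idx n → ℕ → Pt n → ℝ → ℂ, IsPathFamily U p ∧
          ∀ j, ∀ r ≤ j.card, ∀ t ∈ Set.Icc (0 : ℝ) 1, p j r x₀ t = p₀ j r t) ∧
    -- every branch
    (∀ U : Set (Pt n), IsOpen U → U ⊆ S n →
      ∀ p : Idx n → ℕ → Pt n → ℝ → ℂ, IsPathFamily U p →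
        -- the entries of the connection form are the differentials of the functions `γ`
        (∀ i k : Idx n, k ⊆ i → k.card + 1 = i.card → ∀ x ∈ U,
          HasFDerivAt (fun x' => gamma (retract i k) (sub i x') (fun r => p k r x'))
            (omega x i k) x) ∧
        -- the system, written out for the columns
        (∀ i j : Idx n, ∀ x ∈ U,
          HasFDerivAt (fun x' => varMatrix (fun j r => p j r x') x' i j)
            (∑ k ∈ univ.filter (fun k : Idx n => k ⊆ i ∧ k.card + 1 = i.card),
              varMatrix (fun j r => p j r x) x k j •
                fderiv ℂ (fun x' => gamma (retract i k) (sub i x') (fun r => p k r x')) x) x) ∧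
        -- the columns are solutions of `dX = ω X`, and they are a fundamental system
        (∀ j : Idx n, IsSolution U (fun x i => varMatrix (fun j r => p j r x) x i j)) ∧
        (∀ x ∈ U, IsUnit (varMatrix (fun j r => p j r x) x).det) ∧
        (IsConnected U → ∀ X : Pt n → Idx n → ℂ, IsSolution U X →
          ∃! c : Idx n → ℂ, ∀ x ∈ U, X x = varMatrix (fun j r => p j r x) x *ᵥ c)) ∧
    -- the system is unipotent: `ω` is strictly lower triangular
    (∀ x : Pt n, ∀ i j : Idx n, ¬ j ⊂ i → omega x i j = 0) ∧
    -- `ω` is holomorphic on `S_n` and integrable: `dω = 0` and `ω ∧ ω = 0`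
    (∀ i j : Idx n, DifferentiableOn ℂ (fun x => omega x i j) (S n)) ∧
    (∀ i j : Idx n, ∀ x ∈ S n, extDeriv (asAlt fun x' => omega x' i j) x = 0) ∧
    (∀ x ∈ S n, ∀ v w : Pt n, omegaAt x v * omegaAt x w - omegaAt x w * omegaAt x v = 0) ∧
    -- the entries of `ω` are integral combinations of the logarithmic differentials of the
    -- equations of the components of `D_n`
    (∀ i j : Idx n, ∃ (e : Fin n → ℤ) (f : Fin n → Fin n → ℤ), ∀ x ∈ S n,
      omega x i j = ∑ s, e s • dlog (fun x' : Pt n => x' s) x +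
        ∑ s, ∑ t ∈ univ.filter (fun t => s ≤ t),
          f s t • dlog (fun x' : Pt n => 1 - ∏ α ∈ Icc s t, x' α) x) ∧
    -- they have logarithmic poles on `CP^n`, in each of the standard charts, along the union of
    -- `D_n` and the hyperplane at infinity
    (∀ i j : Idx n, ∀ m : Fin (n + 1),
      HasLogPoles (divisorEq m) (inChart m fun x => omega x i j)) := by
  refine ⟨fun x₀ hx₀ => exists_isPathSystem hx₀, fun x₀ hx₀ p₀ hp₀ => exists_isPathFamily hx₀ hp₀,
    fun U hU hUS p hp => ?_, fun x i j h => ?_,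
    fun i j x hx => (differentiableAt_omega i j hx).differentiableWithinAt, fun i j x hx => ?_,
    fun x hx v w => omegaAt_comm hx v w, isIntegralComb_omega, hasLogPoles_omega⟩
  · have hcol : ∀ j : Idx n, IsSolution U (fun x i => varMatrix (fun j r => p j r x) x i j) :=
      fun j x hx i => hasFDerivAt_varMatrix hU hUS hp i j hx
    refine ⟨fun i k hki hc x hx => hasFDerivAt_gamma hU hUS hp hki hc hx, fun i j x hx => ?_, hcol,
      fun x _ => (isUnit_iff_isUnit_det _).1 (isUnit_varMatrix _ x), fun hUc X hX =>
        existsUnique_combination hU hUc hcol (fun x _ => isUnit_varMatrix _ x) hX⟩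
    refine (hasFDerivAt_varMatrix hU hUS hp i j hx).congr_fderiv ?_
    rw [sum_smul_omega (fun k => varMatrix (fun j r => p j r x) x k j)]
    refine sum_congr rfl fun k hk => ?_
    obtain ⟨h1, h2⟩ := (mem_filter.1 hk).2
    rw [(hasFDerivAt_gamma hU hUS hp h1 h2 hx).fderiv]
  · refine omega_eq_zero (fun hji => h (hji.1.ssubset_of_ne ?_)) x
    rintro rfl
    omega
  · obtain ⟨g, hg, hd⟩ := exists_primitive_omega i j hx
    exact extDeriv_asAlt_eq_zero hg hd
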